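/- For positive integers $n,m$ let $T_{n,m}=\mathbb Z/n\mathbb Z\times\mathbb Z/m\mathbb Z$, and let $\phi\colon T_{n,m}\to T_{n,m}$ be the random map (the quenched random walk, or equivalently the uniform cycle-rooted spanning forest) for which $\phi(x,y)$ equals $(x+1,y)$ or $(x,y+1)$ with probability $1/2$ each, independently over the vertices $(x,y)\in T_{n,m}$. A closed orbit (cycle) of $\phi$ has homology class $(p,q)$ if it crosses every vertical line $x=a+\frac12$ exactly $p$ times and every horizontal line $y=b+\frac12$ exactly $q$ times, where $a\in\mathbb Z/n\mathbb Z$ and $b\in\mathbb Z/m\mathbb Z$; let $N_{(p,q)}$ denote the number of closed orbits of homology class $(p,q)$. Let $\rho\in(0,\infty)$. There exist constants $c>0$ and $C>0$, depending only on $\rho$, such that for every sequence $m=m(n)$ of natural numbers with $m=n+\rho\sqrt n\,(1+o(1))$ as $n\to\infty$, the following hold for all sufficiently large $n$ (how large may depend on the sequence): $$\mathbb P\big(\text{every closed orbit of }\phi\text{ has homology class }(1,1)\big)>1-\exp\{-cn^{1/2}\},$$ $$\mathbb P\big(N_{(1,1)}>cn^{1/2}\big)\ge 1-\exp\{-cn^{1/2}\},$$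 $$\mathbb P\big(N_{(1,1)}>Cn^{1/2}\big)\le\exp\{-C^{-1}n^{1/2}\}.$$ -/

import Mathlib

open MeasureTheory Filter Topology Asymptotics

namespace QuenchedWalk

/-- The torus `ℤ² / (nℤ × mℤ)`. -/
abbrev Torus (n m : ℕ) : Type := ZMod n × ZMod m

/-- A choice of an outgoing edge at every vertex of the torus: `true` is the edge pointing right,
to `(x + 1, y)`, and `false` is the edge pointing up, to `(x, y + 1)`. Equivalently, a
cycle-rooted spanning forest of the directed torus. -/
abbrev Config (n m : ℕ) : Type := Torus n m → Bool

/-- The quenched random walk of a configuration, as a self-map of the torus. -/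
def walk {n m : ℕ} (ω : Config n m) (v : Torus n m) : Torus n m :=
  if ω v = true then (v.1 + 1, v.2) else (v.1, v.2 + 1)

/-- The law of the configuration: right and up have probability `1 / 2` each, independently over
the vertices of the torus. -/
noncomputable def law (n m : ℕ) : Measure (Config n m) :=
  Measure.infinitePi fun _ : Torus n m => (PMF.uniformOfFintype Bool).toMeasure

/-- `C` is (the vertex set of) a closed orbit of the quenched random walk. -/
def IsClosedOrbit {n m : ℕ} (ω : Config n m) (C : Set (Torus n m)) : Prop :=
  ∃ v ∈ Function.periodicPts (walk ω), C = {w | w ∈ Function.periodicOrbit (walk ω) v}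

/-- The closed orbit `C` has homology class `(p, q)`: it crosses every vertical line
`x = a + 1/2` exactly `p` times (by a right step from a vertex of abscissa `a`), and every
horizontal line `y = b + 1/2` exactly `q` times (by an up step from a vertex of ordinate `b`). -/
def HasHomologyClass {n m : ℕ} (ω : Config n m) (C : Set (Torus n m)) (p q : ℕ) : Prop :=
  (∀ a : ZMod n, {v | v ∈ C ∧ v.1 = a ∧ ω v = true}.ncard = p) ∧
    ∀ b : ZMod m, {v | v ∈ C ∧ v.2 = b ∧ ω v = false}.ncard = q

/-- The number of closed orbits of homology class `(p, q)`. -/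
noncomputable def numCycles {n m : ℕ} (p q : ℕ) (ω : Config n m) : ℕ :=
  {C : Set (Torus n m) | IsClosedOrbit ω C ∧ HasHomologyClass ω C p q}.ncard

end QuenchedWalk

/-!
A walk which has not yet closed up has only met fresh coins, so an event about a self-avoiding piece
of trajectory is at most as likely as the same event about independent coin tosses.

* *Off-diagonal classes.* An orbit of class `(p, q)` makes `p * n` right steps and `q * m` up steps.
  The number of right steps in a window of `n + m` consecutive steps changes by at most one when the
  window slides by one step, and the walk closes up as soon as it equals `n`. A self-avoiding walk
  through `J` disjoint windows therefore has all of them on the same side of `n`, which has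
  probability at most `2 * (1 - δ) ^ J` with `δ` bounded below since `|m - n| = O(√n)`. So only
  orbits consisting of at most `ε * √n` windows matter, and for these `p ≠ q` forces
  `(p * n - q * m) ^ 2` to exceed the length of the orbit by a factor of order `√n`, which has a
  small binomial probability.
* *Upper tail.* Each cycle of class `(1, 1)` leaves the column `x = 0` exactly once. If the walks
  from `k` given points of this column are distinct such cycles, they reveal `(n + m) * k` fresh
  coins, which has probability at most `coinProb (n + m) n ^ k`; summing over the sets of points
  bounds the mean of `2 ^ N`, where `N` is the number of cycles of class `(1, 1)`.
* *Lower tail.* Let `P` be the transition matrix of the walk and `0 ≤ s < 1`. By multilinearity in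
  the rows, `det (1 - s • P)` has mean `det (1 - s • Q)`, with `Q` the annealed transition matrix.
  If all cycles are of class `(1, 1)`, then `det (1 - s • P) = (1 - s ^ (n + m)) ^ N`. On the other
  hand `-log (det (1 - s • Q)) = ∑ s ^ k * tr (Q ^ k) / k`, whose term `k = n + m` alone is of order
  `√n` when `s ^ (n + m) = 1 / 2`. Conclude with Markov's inequality.
-/

namespace QuenchedWalk

section LogDet

open Polynomial

variable {V K : Type*} [Fintype V] [DecidableEq V] [Field K] [IsAlgClosed K]

theorem card_roots_charpoly (M : Matrix V V K) : M.charpoly.roots.card = Fintype.card V := by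
  rw [← (IsAlgClosed.splits M.charpoly).natDegree_eq_card_roots, M.charpoly_natDegree_eq_dim]

theorem det_sub_algebraMap (M : Matrix V V K) (a : K) :
    (M - algebraMap K _ a).det = (M.charpoly.roots.map fun l => l - a).prod := by
  have hdet : (algebraMap K (Matrix V V K) a - M).det
      = (M.charpoly.roots.map fun l => a - l).prod := by
    rw [show (algebraMap K (Matrix V V K) a - M).det = M.charpoly.eval a by
      rw [Matrix.eval_charpoly]; rfl]
    conv_lhs => rw [(IsAlgClosed.splits M.charpoly).eq_prod_roots_of_monic M.charpoly_monic]
    simp [eval_multiset_prod]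
  rw [← neg_sub, Matrix.det_neg, hdet, ← card_roots_charpoly M,
    ← Multiset.card_map (fun l => a - l), ← Multiset.prod_map_neg, Multiset.map_map]
  simp

theorem det_aeval (M : Matrix V V K) (p : K[X]) :
    (aeval M p).det = (M.charpoly.roots.map fun l => p.eval l).prod := by
  obtain ⟨c, s, rfl⟩ : ∃ (c : K) (s : Multiset K), p = C c * (s.map fun b => X - C b).prod :=
    ⟨_, _, (IsAlgClosed.splits p).eq_prod_roots⟩
  simp only [map_mul, Matrix.det_mul, eval_mul, eval_C, aeval_C, Multiset.prod_map_mul]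
  congr 1
  · simp [Algebra.algebraMap_eq_smul_one, card_roots_charpoly]
  · induction s using Multiset.induction with
    | empty => simp
    | cons b s ih =>
      simp only [Multiset.map_cons, Multiset.prod_cons, map_mul, Matrix.det_mul, eval_mul, ih,
        Multiset.prod_map_mul, map_sub, aeval_X, aeval_C, det_sub_algebraMap, eval_sub, eval_X,
        eval_C]

theorem charpoly_aeval (M : Matrix V V K) (p : K[X]) :
    (aeval M p).charpoly = (M.charpoly.roots.map fun l => X - C (p.eval l)).prod := by
  refine Polynomial.funext fun x => ?_
  have eval_charpoly : (aeval M p).charpoly.eval x = (aeval M (C x - p)).det := by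
    rw [Matrix.eval_charpoly, map_sub, aeval_C]; rfl
  rw [eval_charpoly, det_aeval, eval_multiset_prod, Multiset.map_map]
  simp

theorem trace_pow_eq_sum_roots (M : Matrix V V K) (k : ℕ) :
    (M ^ k).trace = (M.charpoly.roots.map fun l => l ^ k).sum := by
  have h := charpoly_aeval M (X ^ k)
  simp only [map_pow (aeval M), aeval_X, eval_pow, eval_X] at h
  have h_map : (M.charpoly.roots.map fun l => X - C (l ^ k))
      = (M.charpoly.roots.map fun l => l ^ k).map fun a => X - C a := by
    rw [Multiset.map_map]; rfl
  rw [Matrix.trace_eq_sum_roots_charpoly, h, h_map, roots_multiset_prod_X_sub_C]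

theorem norm_le_of_mem_roots_charpoly {M : Matrix V V ℂ} {s : ℝ} (hM : ∀ i, ∑ j, ‖M i j‖ ≤ s)
    {l : ℂ} (hl : l ∈ M.charpoly.roots) : ‖l‖ ≤ s := by
  have hV : Nonempty V := by
    rw [← Fintype.card_pos_iff, ← card_roots_charpoly M]
    exact Multiset.card_pos_iff_exists_mem.2 ⟨l, hl⟩
  let _ : NormedRing (Matrix V V ℂ) := Matrix.linftyOpNormedRing
  let _ : NormedAlgebra ℂ (Matrix V V ℂ) := Matrix.linftyOpNormedAlgebra
  have : NormOneClass (Matrix V V ℂ) := Matrix.linfty_opNormOneClass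
  have : CompleteSpace (Matrix V V ℂ) := inferInstanceAs (CompleteSpace (V → V → ℂ))
  refine (spectrum.norm_le_norm_of_mem
    (Matrix.mem_spectrum_iff_isRoot_charpoly.2 (isRoot_of_mem_roots hl))).trans ?_
  lift s to NNReal using (Finset.sum_nonneg fun j _ => norm_nonneg _).trans (hM hV.some)
  rw [Matrix.linfty_opNorm_def, NNReal.coe_le_coe]
  exact Finset.sup_le fun i _ => by
    rw [← NNReal.coe_le_coe]
    simpa using hM i

theorem exists_hasSum_trace_pow_div_complex {M : Matrix V V ℂ} {s : ℝ} (hs : s < 1)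
    (hM : ∀ i, ∑ j, ‖M i j‖ ≤ s) :
    ∃ S : ℂ, HasSum (fun k : ℕ => (M ^ k).trace / k) S ∧ (1 - M).det = Complex.exp (-S) := by
  have hl : ∀ l ∈ M.charpoly.roots, ‖l‖ < 1 := fun l h =>
    (norm_le_of_mem_roots_charpoly hM h).trans_lt hs
  have hdet := det_aeval M (1 - X)
  simp only [map_sub, map_one, aeval_X, eval_sub, eval_one, eval_X] at hdet
  simp only [hdet, trace_pow_eq_sum_roots]
  generalize M.charpoly.roots = t at hl
  induction t using Multiset.induction with
  | empty => exact ⟨0, by simp, by simp⟩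
  | cons a t ih =>
    obtain ⟨S, hS, hprod⟩ := ih fun l h => hl l (Multiset.mem_cons_of_mem h)
    have ha := hl a (Multiset.mem_cons_self a t)
    refine ⟨-Complex.log (1 - a) + S, ?_, ?_⟩
    · convert! (Complex.hasSum_taylorSeries_neg_log ha).add hS using 2 with k
      simp [add_div]
    · rw [Multiset.map_cons, Multiset.prod_cons, hprod, neg_add, neg_neg, Complex.exp_add,
        Complex.exp_log]
      rintro h0
      simp [← sub_eq_zero.1 h0] at ha

theorem det_one_sub_pos_and_hasSum_trace_pow_div {M : Matrix V V ℝ} {s : ℝ} (hs : s < 1)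
    (hM : ∀ i, ∑ j, |M i j| ≤ s) :
    0 < (1 - M).det ∧
      HasSum (fun k : ℕ => (M ^ k).trace / k) (-Real.log (1 - M).det) := by
  obtain ⟨S, hS, hdet⟩ := exists_hasSum_trace_pow_div_complex (M := M.map Complex.ofReal) hs
    (by simpa using hM)
  have htrace (k : ℕ) :
      ((M.map Complex.ofReal) ^ k).trace / k = (((M ^ k).trace / k : ℝ) : ℂ) := by
    rw [show (M.map Complex.ofReal) ^ k = (M ^ k).map Complex.ofReal from
      (map_pow Complex.ofRealHom.mapMatrix M k).symm]
    simp [Matrix.trace]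
  simp only [htrace] at hS
  have hre : HasSum (fun k : ℕ => (M ^ k).trace / k) S.re := by
    simpa using Complex.hasSum_re hS
  have hS_re : S = (S.re : ℂ) := hS.unique (Complex.hasSum_ofReal.2 hre)
  have hdet_ofReal : (1 - M.map Complex.ofReal).det = ((1 - M).det : ℂ) := by
    rw [show 1 - M.map Complex.ofReal = Complex.ofRealHom.mapMatrix (1 - M) by
      rw [map_sub, map_one]; rfl, ← RingHom.map_det]
    rfl
  rw [hdet_ofReal, hS_re] at hdet
  have hexp : (1 - M).det = Real.exp (-S.re) := by exact_mod_cast hdet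
  rw [hexp, Real.log_exp, neg_neg]
  exact ⟨Real.exp_pos _, hre⟩

end LogDet

section CoinTosses

/-- The probability that exactly `j` of `N` independent fair coins come up heads. -/
noncomputable def coinProb (N j : ℕ) : ℝ := N.choose j / 2 ^ N

theorem coinProb_nonneg (N j : ℕ) : 0 ≤ coinProb N j := by unfold coinProb; positivity

theorem coinProb_eq_zero_of_lt {N j : ℕ} (h : N < j) : coinProb N j = 0 := by
  simp [coinProb, Nat.choose_eq_zero_of_lt h]

theorem coinProb_add_symm (i j : ℕ) : coinProb (i + j) i = coinProb (j + i) j := by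
  rw [coinProb, coinProb, add_comm j, Nat.choose_symm_add]

theorem coinProb_succ_succ (N j : ℕ) :
    coinProb (N + 1) (j + 1) = (coinProb N j + coinProb N (j + 1)) / 2 := by
  simp only [coinProb, Nat.choose_succ_succ', pow_succ]
  push_cast
  field_simp

theorem coinProb_succ {N j : ℕ} (h : j ≤ N) :
    coinProb (N + 1) j = coinProb N j * ((N + 1) / (2 * (N + 1 - j))) := by
  have hsub : ((N + 1 - j : ℕ) : ℝ) = N + 1 - j := by
    rw [Nat.cast_sub (by lia)]; push_cast; ring
  have hpos : (0 : ℝ) < N + 1 - j := by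
    have : (j : ℝ) ≤ N := by exact_mod_cast h
    linarith
  have hchoose : (N.choose j : ℝ) * (N + 1) = (N + 1).choose j * (N + 1 - j) := by
    rw [← hsub]; exact_mod_cast Nat.choose_mul_succ_eq N j
  rw [coinProb, coinProb, pow_succ, eq_div_of_mul_eq hpos.ne' hchoose.symm]
  field_simp

theorem coinProb_two_mul_succ (n : ℕ) :
    coinProb (2 * (n + 1)) (n + 1) = coinProb (2 * n) n * ((2 * n + 1) / (2 * n + 2)) := by
  have h : ((n : ℝ) + 1) * Nat.centralBinom (n + 1) = 2 * (2 * n + 1) * Nat.centralBinom n := by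
    exact_mod_cast Nat.succ_mul_centralBinom_succ n
  simp only [coinProb, ← Nat.centralBinom_eq_two_mul_choose, pow_mul, pow_succ]
  field_simp
  linarith

theorem coinProb_two_mul_sq_le (n : ℕ) : (2 * n + 1) * coinProb (2 * n) n ^ 2 ≤ 1 := by
  induction n with
  | zero => simp [coinProb]
  | succ n ih =>
    calc (2 * ((n + 1 : ℕ) : ℝ) + 1) * coinProb (2 * (n + 1)) (n + 1) ^ 2
        = (2 * n + 1) * coinProb (2 * n) n ^ 2
            * ((2 * n + 3) * (2 * n + 1) / (2 * n + 2) ^ 2) := by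
          rw [coinProb_two_mul_succ]; push_cast; field_simp; ring
      _ ≤ 1 * 1 := by
          gcongr
          rw [div_le_one (by positivity)]
          nlinarith
      _ = 1 := one_mul 1

theorem le_coinProb_two_mul_sq {n : ℕ} (hn : 1 ≤ n) : 1 ≤ 4 * n * coinProb (2 * n) n ^ 2 := by
  induction n, hn using Nat.le_induction with
  | base => norm_num [coinProb]
  | succ n hn ih =>
    have hn' : (1 : ℝ) ≤ n := by exact_mod_cast hn
    calc (1 : ℝ) = 1 * 1 := (one_mul 1).symm
      _ ≤ (4 * n * coinProb (2 * n) n ^ 2) * ((n + 1) / n * ((2 * n + 1) / (2 * n + 2)) ^ 2) := by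
          gcongr
          rw [div_pow, div_mul_div_comm, le_div_iff₀ (by positivity)]
          nlinarith
      _ = 4 * ((n + 1 : ℕ) : ℝ) * coinProb (2 * (n + 1)) (n + 1) ^ 2 := by
          rw [coinProb_two_mul_succ]; push_cast; field_simp

theorem coinProb_le_coinProb_two_mul {n N : ℕ} (h : 2 * n ≤ N) (j : ℕ) :
    coinProb N j ≤ coinProb (2 * n) n := by
  induction N, h using Nat.le_induction generalizing j with
  | base =>
    unfold coinProb
    gcongr
    exact Nat.choose_le_centralBinom j n
  | succ N _ ih =>
    cases j with
    | zero =>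
      refine le_trans ?_ (ih 0)
      rw [coinProb, coinProb, Nat.choose_zero_right, Nat.choose_zero_right]
      gcongr <;> simp
    | succ j =>
      rw [coinProb_succ_succ]
      linarith [ih j, ih (j + 1)]

theorem coinProb_le_one_div_sqrt {N : ℕ} (hN : N ≠ 0) (j : ℕ) : coinProb N j ≤ 1 / √N := by
  have hN' : (0 : ℝ) < N := by positivity
  have hdiv : (N : ℝ) ≤ 2 * (N / 2 : ℕ) + 1 := by exact_mod_cast (by lia : N ≤ 2 * (N / 2) + 1)
  have hle := coinProb_le_coinProb_two_mul (Nat.mul_div_le N 2) j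
  have hsq := coinProb_two_mul_sq_le (N / 2)
  refine (Real.le_sqrt_of_sq_le (y := 1 / N) ?_).trans_eq
    (by rw [Real.sqrt_div zero_le_one, Real.sqrt_one])
  rw [le_div_iff₀ hN']
  have hle_sq := pow_le_pow_left₀ (coinProb_nonneg N j) hle 2
  nlinarith [sq_nonneg (coinProb (2 * (N / 2)) (N / 2))]

theorem exp_div_le_coinProb_two_mul_add {n : ℕ} (hn : 1 ≤ n) (d : ℕ) :
    Real.exp (-(d ^ 2 / n)) / (2 * √n) ≤ coinProb (2 * n + d) n := by
  have : (0 : ℝ) < n := by exact_mod_cast hn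
  induction d with
  | zero =>
    have hsq := le_coinProb_two_mul_sq hn
    simp only [Nat.cast_zero, ne_eq, OfNat.ofNat_ne_zero, not_false_eq_true, zero_pow, zero_div,
      neg_zero, Real.exp_zero, add_zero]
    refine (sq_le_sq₀ (by positivity) (coinProb_nonneg _ _)).1 ?_
    rw [div_pow, mul_pow, Real.sq_sqrt (by positivity), div_le_iff₀ (by positivity)]
    linarith
  | succ d ih =>
    have hratio : Real.exp (-((d + 1) / n)) ≤
        ((2 * n + d : ℕ) + 1) / (2 * ((2 * n + d : ℕ) + 1 - n)) := by
      have hexp : (d + 1) / n + 1 ≤ Real.exp ((d + 1) / n : ℝ) := Real.add_one_le_exp _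
      rw [Real.exp_neg]
      refine (inv_anti₀ (by positivity) hexp).trans ?_
      push_cast
      rw [show 2 * (n : ℝ) + d + 1 - n = n + d + 1 by ring, inv_eq_one_div,
        div_le_div_iff₀ (by positivity) (by positivity),
        show (2 * n + d + 1 : ℝ) * ((d + 1) / n + 1)
          = 1 * (2 * (n + d + 1)) + ((d + 1) + (d + 1) ^ 2 / n) by field_simp; ring]
      exact le_add_of_nonneg_right (by positivity)
    calc Real.exp (-((d + 1 : ℕ) ^ 2 / n)) / (2 * √n)
        ≤ Real.exp (-(d ^ 2 / n) + -((d + 1) / n)) / (2 * √n) := by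
          rw [← neg_add, ← add_div]
          gcongr
          push_cast
          nlinarith [(Nat.cast_nonneg d : (0 : ℝ) ≤ d)]
      _ = Real.exp (-(d ^ 2 / n)) / (2 * √n) * Real.exp (-((d + 1) / n)) := by
          rw [Real.exp_add, div_mul_eq_mul_div]
      _ ≤ coinProb (2 * n + d) n * (((2 * n + d : ℕ) + 1) / (2 * ((2 * n + d : ℕ) + 1 - n))) :=
          mul_le_mul ih hratio (by positivity) (coinProb_nonneg _ _)
      _ = coinProb (2 * n + (d + 1)) n := by
          rw [← add_assoc, coinProb_succ (by lia)]

theorem exp_div_le_coinProb {i j l : ℕ} (hl : 1 ≤ l) (hi : l ≤ i) (hj : l ≤ j) :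
    Real.exp (-(((i : ℝ) - j) ^ 2 / l)) / (2 * √(i + j : ℕ)) ≤ coinProb (i + j) i := by
  wlog hij : i ≤ j generalizing i j
  · rw [coinProb_add_symm, ← neg_sub, neg_sq, add_comm i]
    exact this hj hi (by lia)
  obtain ⟨d, rfl⟩ := Nat.exists_eq_add_of_le hij
  have hi_pos : (0 : ℝ) < i := by exact_mod_cast hl.trans hi
  have : (0 : ℝ) < l := by exact_mod_cast hl
  refine le_trans ?_ ((exp_div_le_coinProb_two_mul_add (hl.trans hi) d).trans_eq
    (by rw [two_mul, add_assoc]))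
  push_cast
  rw [sub_add_cancel_left, neg_sq]
  gcongr
  linarith [(Nat.cast_nonneg d : (0 : ℝ) ≤ d)]

theorem coinProb_le_exp {N : ℕ} (hN : N ≠ 0) (j : ℕ) :
    coinProb N j ≤ Real.exp (-((2 * j - N : ℝ) ^ 2 / (2 * N))) := by
  rcases lt_or_ge N j with hj | hj
  · rw [coinProb_eq_zero_of_lt hj]; positivity
  set t : ℝ := (2 * j - N) / N with ht
  have hterm : Real.exp t ^ j * Real.exp (-t) ^ (N - j) = Real.exp (t * (2 * j - N)) := by
    rw [← Real.exp_nat_mul, ← Real.exp_nat_mul, ← Real.exp_add, Nat.cast_sub hj]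
    ring_nf
  have hmgf : Real.exp (t * (2 * j - N)) * N.choose j ≤ 2 ^ N * Real.exp (N * (t ^ 2 / 2)) :=
    calc Real.exp (t * (2 * j - N)) * N.choose j
        ≤ (Real.exp t + Real.exp (-t)) ^ N := by
          rw [← hterm, add_pow]
          exact Finset.single_le_sum
            (f := fun i => Real.exp t ^ i * Real.exp (-t) ^ (N - i) * (N.choose i : ℝ))
            (fun i _ => by positivity) (Finset.mem_range.2 (by lia))
      _ = 2 ^ N * Real.cosh t ^ N := by rw [Real.cosh_eq, ← mul_pow]; ring_nf
      _ ≤ 2 ^ N * Real.exp (N * (t ^ 2 / 2)) := by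
          rw [Real.exp_nat_mul]
          gcongr
          exact Real.cosh_le_exp_half_sq t
  have hexponent : -((2 * j - N : ℝ) ^ 2 / (2 * N)) = N * (t ^ 2 / 2) - t * (2 * j - N) := by
    rw [ht]; field_simp; ring
  rw [coinProb, div_le_iff₀ (by positivity), hexponent, Real.exp_sub, div_mul_eq_mul_div,
    le_div_iff₀ (Real.exp_pos _)]
  linarith

theorem card_filter_powerset_card_notMem (N : ℕ) {T : Finset ℕ} {δ : ℝ}
    (hδ : δ ≤ ∑ j ∈ T, coinProb N j) :
    (((Finset.range N).powerset.filter fun B => B.card ∉ T).card : ℝ) ≤ (1 - δ) * 2 ^ N := by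
  have hmem : ((Finset.range N).powerset.filter fun B => B.card ∈ T).card
      = ∑ j ∈ T, N.choose j := by
    rw [Finset.card_eq_sum_card_fiberwise (f := Finset.card) (t := T)
      fun B hB => by simpa using (Finset.mem_filter.1 hB).2]
    refine Finset.sum_congr rfl fun j hj => ?_
    rw [Finset.filter_filter, ← Finset.card_range N, ← Finset.card_powersetCard,
      Finset.powersetCard_eq_filter, Finset.card_range]
    congr 1
    ext B
    simp only [Finset.mem_filter, and_congr_right_iff]
    rintro -
    exact ⟨And.right, by rintro rfl; exact ⟨hj, rfl⟩⟩
  have hadd := Finset.card_filter_add_card_filter_not (s := (Finset.range N).powerset)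
    (fun B => B.card ∈ T)
  rw [Finset.card_powerset, Finset.card_range, hmem] at hadd
  have hadd' : (∑ j ∈ T, (N.choose j : ℝ))
      + ((Finset.range N).powerset.filter fun B => B.card ∉ T).card = 2 ^ N := by
    exact_mod_cast hadd
  simp only [coinProb, ← Finset.sum_div] at hδ
  rw [le_div_iff₀ (by positivity)] at hδ
  linarith

end CoinTosses

section Orbits

open Function

variable {n m : ℕ}

/-- The number of steps of type `b` (`true` for right, `false` for up) among the first `k` steps of
the walk started at `v`. -/
def steps (ω : Config n m) (v : Torus n m) (b : Bool) (k : ℕ) : ℕ :=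
  Nat.count (fun i => ω ((walk ω)^[i] v) = b) k

variable (ω : Config n m) (v : Torus n m) (b : Bool)

theorem steps_zero : steps ω v b 0 = 0 :=
  Nat.count_zero _

theorem steps_succ (k : ℕ) :
    steps ω v b (k + 1) = steps ω v b k + if ω ((walk ω)^[k] v) = b then 1 else 0 :=
  Nat.count_succ _ _

theorem steps_add (k l : ℕ) :
    steps ω v b (k + l) = steps ω v b k + steps ω ((walk ω)^[k] v) b l := by
  simp only [steps, Nat.count_add, ← iterate_add_apply]
  simp only [add_comm]

theorem steps_mul (p k : ℕ) :
    steps ω v b (p * k) = ∑ i ∈ Finset.range p, steps ω ((walk ω)^[i * k] v) b k := by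
  induction p with
  | zero => simp [steps_zero]
  | succ p ih => rw [Nat.succ_mul, steps_add, ih, Finset.sum_range_succ]

theorem steps_true_add_steps_false (k : ℕ) : steps ω v true k + steps ω v false k = k := by
  induction k with
  | zero => simp [steps_zero]
  | succ k ih =>
    rw [steps_succ, steps_succ]
    cases ω ((walk ω)^[k] v) <;> simp <;> lia

theorem iterate_walk (k : ℕ) :
    (walk ω)^[k] v = (v.1 + steps ω v true k, v.2 + steps ω v false k) := by
  induction k with
  | zero => simp [steps_zero]
  | succ k ih =>
    rw [steps_succ, steps_succ, iterate_succ_apply', walk, ih]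
    cases ω (v.1 + steps ω v true k, v.2 + steps ω v false k) <;> simp [add_assoc]

theorem exists_eq_or_forall_lt_or_forall_gt {f : ℕ → ℕ}
    (hf : ∀ t, f (t + 1) ≤ f t + 1 ∧ f t ≤ f (t + 1) + 1) (j T : ℕ) :
    (∃ t ≤ T, f t = j) ∨ (∀ t ≤ T, f t < j) ∨ ∀ t ≤ T, j < f t := by
  induction T with
  | zero =>
    simp only [Nat.le_zero, exists_eq_left, forall_eq]
    lia
  | succ T ih => grind

theorem exists_steps_iterate_eq_or (k j T : ℕ) :
    (∃ t ≤ T, steps ω ((walk ω)^[t] v) b k = j) ∨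
      (∀ t ≤ T, steps ω ((walk ω)^[t] v) b k < j) ∨
        ∀ t ≤ T, j < steps ω ((walk ω)^[t] v) b k := by
  refine exists_eq_or_forall_lt_or_forall_gt
    (f := fun t => steps ω ((walk ω)^[t] v) b k) (fun t => ?_) j T
  have hshift := steps_add ω v b (t + 1) k
  rw [show t + 1 + k = t + k + 1 by ring, steps_succ, steps_succ, steps_add] at hshift
  split_ifs at hshift <;> lia

variable {ω v b}

theorem exists_steps_iterate_eq {p k j : ℕ} (hp : p ≠ 0) (h : steps ω v b (p * k) = p * j) :
    ∃ t, steps ω ((walk ω)^[t] v) b k = j := by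
  have hp_range : (Finset.range p).Nonempty := Finset.nonempty_range_iff.2 hp
  have hblock : ∀ i ∈ Finset.range p, i * k ≤ p * k := fun i hi =>
    Nat.mul_le_mul_right _ (Finset.mem_range.1 hi).le
  have hsum : ∑ i ∈ Finset.range p, steps ω ((walk ω)^[i * k] v) b k
      = ∑ _i ∈ Finset.range p, j := by
    rw [← steps_mul, h, Finset.sum_const, Finset.card_range, smul_eq_mul]
  rcases exists_steps_iterate_eq_or ω v b k j (p * k) with ⟨t, -, ht⟩ | hlt | hgt
  · exact ⟨t, ht⟩
  · exact absurd hsum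
      (Finset.sum_lt_sum_of_nonempty hp_range fun i hi => hlt _ (hblock i hi)).ne
  · exact absurd hsum
      (Finset.sum_lt_sum_of_nonempty hp_range fun i hi => hgt _ (hblock i hi)).ne'

theorem steps_false_eq (h : steps ω v true (n + m) = n) : steps ω v false (n + m) = m := by
  have := steps_true_add_steps_false ω v (n + m)
  lia

theorem isPeriodicPt_of_steps_eq (h : steps ω v true (n + m) = n) :
    IsPeriodicPt (walk ω) (n + m) v := by
  rw [IsPeriodicPt, IsFixedPt, iterate_walk, h, steps_false_eq h]
  simp

theorem minimalPeriod_of_mul_steps_eq [NeZero n] [NeZero m] (hv : v ∈ periodicPts (walk ω))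
    (h : n * steps ω v false (minimalPeriod (walk ω) v)
      = m * steps ω v true (minimalPeriod (walk ω) v)) :
    minimalPeriod (walk ω) v = n + m ∧ steps ω v true (n + m) = n := by
  have hperiod_pos := minimalPeriod_pos_of_mem_periodicPts hv
  have hfix : (walk ω)^[minimalPeriod (walk ω) v] v = v := isPeriodicPt_minimalPeriod (walk ω) v
  rw [iterate_walk, Prod.ext_iff] at hfix
  simp only [add_eq_left, ZMod.natCast_eq_zero_iff] at hfix
  obtain ⟨⟨p, hp⟩, q, hq⟩ := hfix
  have hpq : p = q := by
    rw [hp, hq] at h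
    exact Nat.eq_of_mul_eq_mul_left (Nat.mul_pos (NeZero.pos n) (NeZero.pos m)) (by linarith)
  have hperiod : minimalPeriod (walk ω) v = p * (n + m) := by
    rw [← steps_true_add_steps_false ω v (minimalPeriod (walk ω) v), hp, hq, ← hpq]
    ring
  have hp0 : p ≠ 0 := by
    rintro rfl
    lia
  obtain ⟨t, ht⟩ := exists_steps_iterate_eq (k := n + m) (j := n) hp0
    (by rw [← hperiod, hp, mul_comm])
  have hdvd := (isPeriodicPt_of_steps_eq ht).minimalPeriod_dvd
  rw [minimalPeriod_apply_iterate hv, hperiod] at hdvd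
  have hp1 : p = 1 := by
    have hle := Nat.le_of_dvd (by have := NeZero.pos n; lia) hdvd
    have := NeZero.pos n
    nlinarith [Nat.pos_of_ne_zero hp0]
  rw [hp1, one_mul] at hperiod
  exact ⟨hperiod, by rw [← hperiod, hp, hp1, mul_one]⟩

theorem mem_periodicOrbit_iff_lt {α : Type*} {f : α → α} {x y : α} :
    y ∈ periodicOrbit f x ↔ ∃ i < minimalPeriod f x, f^[i] x = y := by
  simp [periodicOrbit, eq_comm]

theorem ncard_periodicOrbit_inter {α : Type*} (f : α → α) (x : α) (c : α → Prop)
    [DecidablePred c] :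
    {y | y ∈ periodicOrbit f x ∧ c y}.ncard
      = ((Finset.range (minimalPeriod f x)).filter fun i => c (f^[i] x)).card := by
  have himage : {y | y ∈ periodicOrbit f x ∧ c y} = (fun i => f^[i] x) ''
      (((Finset.range (minimalPeriod f x)).filter fun i => c (f^[i] x) : Finset ℕ) : Set ℕ) := by
    ext y
    simp only [Set.mem_ofPred_eq, mem_periodicOrbit_iff_lt, Set.mem_image, Finset.coe_filter,
      Finset.mem_range]
    grind
  rw [himage, Set.InjOn.ncard_image, Set.ncard_coe_finset]
  refine iterate_injOn_Iio_minimalPeriod.mono fun i hi => ?_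
  simpa using (Finset.mem_filter.1 (Finset.mem_coe.1 hi)).1

theorem steps_minimalPeriod_eq_sum_ncard {α : Type*} [Fintype α] (x : Torus n m → α) :
    steps ω v b (minimalPeriod (walk ω) v)
      = ∑ a, {w | w ∈ periodicOrbit (walk ω) v ∧ x w = a ∧ ω w = b}.ncard := by
  classical
  rw [steps, Nat.count_eq_card_filter_range,
    Finset.card_eq_sum_card_fiberwise (f := fun i => x ((walk ω)^[i] v)) (t := Finset.univ)
      fun _ _ => Finset.mem_coe.2 (Finset.mem_univ _)]
  refine Finset.sum_congr rfl fun a _ => ?_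
  rw [ncard_periodicOrbit_inter _ _ fun w => x w = a ∧ ω w = b, Finset.filter_filter]
  simp only [and_comm]

theorem card_filter_add_count_eq {N : ℕ} [NeZero N] {P : ℕ → Prop} [DecidablePred P] {L : ℕ}
    (hL : Nat.count P L = N) (s a : ZMod N) :
    ((Finset.range L).filter fun i => s + (Nat.count P i : ZMod N) = a ∧ P i).card = 1 := by
  have hval : (a - s).val < Nat.count P L := (ZMod.val_lt _).trans_eq hL.symm
  have hval_card : ∀ hf : (Set.ofPred P).Finite, (a - s).val < hf.toFinset.card := fun hf =>
    hval.trans_le (Nat.count_le_card hf L)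
  refine Finset.card_eq_one.2 ⟨Nat.nth P (a - s).val, Finset.ext fun i => ?_⟩
  simp only [Finset.mem_filter, Finset.mem_range, Finset.mem_singleton]
  constructor
  · rintro ⟨hi, rfl, hP⟩
    rw [add_sub_cancel_left, ZMod.val_natCast,
      Nat.mod_eq_of_lt ((Nat.count_strict_mono hP hi).trans_eq hL), Nat.nth_count hP]
  · rintro rfl
    refine ⟨Nat.nth_lt_of_lt_count hval, ?_, Nat.nth_mem _ hval_card⟩
    rw [Nat.count_nth hval_card, ZMod.natCast_zmod_val, add_sub_cancel]

theorem ncard_crossing_eq_one {N : ℕ} [NeZero N] {x : Torus n m → ZMod N}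
    (hx : ∀ i, x ((walk ω)^[i] v) = x v + steps ω v b i)
    (hN : steps ω v b (minimalPeriod (walk ω) v) = N) (a : ZMod N) :
    {w | w ∈ periodicOrbit (walk ω) v ∧ x w = a ∧ ω w = b}.ncard = 1 := by
  rw [ncard_periodicOrbit_inter _ _ fun w => x w = a ∧ ω w = b]
  simp only [hx]
  exact card_filter_add_count_eq hN (x v) a

theorem hasHomologyClass_one_one_iff [NeZero n] [NeZero m] :
    HasHomologyClass ω {w | w ∈ periodicOrbit (walk ω) v} 1 1 ↔
      minimalPeriod (walk ω) v = n + m ∧ steps ω v true (n + m) = n := by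
  constructor
  · rintro ⟨hright, hup⟩
    have hn : steps ω v true (minimalPeriod (walk ω) v) = n := by
      rw [steps_minimalPeriod_eq_sum_ncard Prod.fst]
      exact (Finset.sum_congr rfl fun a _ => hright a).trans (by simp [ZMod.card])
    have hm : steps ω v false (minimalPeriod (walk ω) v) = m := by
      rw [steps_minimalPeriod_eq_sum_ncard Prod.snd]
      exact (Finset.sum_congr rfl fun a _ => hup a).trans (by simp [ZMod.card])
    have hperiod := steps_true_add_steps_false ω v (minimalPeriod (walk ω) v)
    rw [hn, hm] at hperiod
    exact ⟨hperiod.symm, by rw [hperiod, hn]⟩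
  · rintro ⟨hperiod, hn⟩
    exact ⟨ncard_crossing_eq_one (x := Prod.fst) (fun i => by rw [iterate_walk])
        (by rw [hperiod, hn]),
      ncard_crossing_eq_one (x := Prod.snd) (fun i => by rw [iterate_walk])
        (by rw [hperiod, steps_false_eq hn])⟩

end Orbits

section Exploration

open Function

variable {n m : ℕ}

instance : IsProbabilityMeasure (law n m) := by unfold law; infer_instance

theorem law_real_cylinder (U : Finset (Torus n m)) (ω₀ : Config n m) :
    (law n m).real {ω | ∀ u ∈ U, ω u = ω₀ u} = (1 / 2) ^ U.card := by
  have h_pi : {ω : Config n m | ∀ u ∈ U, ω u = ω₀ u} = Set.pi U fun u => {ω₀ u} := by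
    ext ω; simp [Set.mem_pi]
  rw [h_pi, Measure.real, law, Measure.infinitePi_pi _ fun _ _ => MeasurableSet.singleton _]
  simp

/-- Exploring a configuration along `U ω` reveals at least `N` fair coins, and the outcome of the
exploration is encoded by `key ω`. -/
theorem law_real_le_card_mul {κ : Type*} {E : Set (Config n m)} (key : Config n m → κ)
    (S : Finset κ) (U : Config n m → Finset (Torus n m)) {N : ℕ} (h_key : ∀ ω ∈ E, key ω ∈ S)
    (h_card : ∀ ω ∈ E, N ≤ (U ω).card)
    (h_agree : ∀ ω ∈ E, ∀ ω' ∈ E, key ω = key ω' → ∀ u ∈ U ω, ω u = ω' u) :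
    (law n m).real E ≤ S.card * (1 / 2) ^ N := by
  have h_cover : E ⊆ ⋃ s ∈ S, {ω | ω ∈ E ∧ key ω = s} := fun ω hω => by
    simp only [Set.mem_iUnion]
    exact ⟨_, h_key ω hω, hω, rfl⟩
  refine (measureReal_mono h_cover (measure_ne_top _ _)).trans
    ((measureReal_biUnion_finset_le _ _).trans ?_)
  rw [← nsmul_eq_mul]
  refine Finset.sum_le_card_nsmul _ _ _ fun s _ => ?_
  rcases {ω | ω ∈ E ∧ key ω = s}.eq_empty_or_nonempty with h_empty | ⟨ω₀, h₀, h₀s⟩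
  · rw [h_empty, measureReal_empty]
    positivity
  · calc (law n m).real {ω | ω ∈ E ∧ key ω = s}
        ≤ (law n m).real {ω | ∀ u ∈ U ω₀, ω u = ω₀ u} := measureReal_mono
          fun ω hω u hu => (h_agree ω₀ h₀ ω hω.1 (h₀s.trans hω.2.symm) u hu).symm
      _ = (1 / 2) ^ (U ω₀).card := law_real_cylinder _ _
      _ ≤ (1 / 2) ^ N :=
          pow_le_pow_of_le_one (by norm_num) (by norm_num) (h_card ω₀ h₀)

/-- The walk started at `v` visits pairwise distinct vertices at the times `0, …, T - 1`. -/
def SelfAvoiding (ω : Config n m) (v : Torus n m) (T : ℕ) : Prop :=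
  Set.InjOn (fun i => (walk ω)^[i] v) (Set.Iio T)

/-- The set of vertices visited by the walk started at `v` at the times `0, …, T - 1`. -/
def trail (ω : Config n m) (v : Torus n m) (T : ℕ) : Finset (Torus n m) :=
  (Finset.range T).image fun i => (walk ω)^[i] v

/-- The set of times before `T` at which the walk started at `v` makes a right step; it encodes the
first `T` steps of the walk. -/
def word (ω : Config n m) (v : Torus n m) (T : ℕ) : Finset ℕ :=
  (Finset.range T).filter fun i => ω ((walk ω)^[i] v) = true

variable {ω ω' : Config n m} {v : Torus n m} {T : ℕ}

theorem SelfAvoiding.mono {T' : ℕ} (h : SelfAvoiding ω v T') (hT : T ≤ T') : SelfAvoiding ω v T :=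
  Set.InjOn.mono (Set.Iio_subset_Iio hT) h

theorem SelfAvoiding.card_trail (h : SelfAvoiding ω v T) : (trail ω v T).card = T := by
  rw [trail, Finset.card_image_of_injOn (by rwa [Finset.coe_range]), Finset.card_range]

theorem word_mem_powerset : word ω v T ∈ (Finset.range T).powerset :=
  Finset.mem_powerset.2 (Finset.filter_subset _ _)

theorem card_word : (word ω v T).card = steps ω v true T := by
  rw [steps, Nat.count_eq_card_filter_range, word]

theorem apply_iterate_eq_of_word_eq (h : word ω v T = word ω' v T) {i : ℕ} (hi : i < T) :
    ω ((walk ω)^[i] v) = ω' ((walk ω')^[i] v) := by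
  simpa [word, hi, ← Bool.eq_iff_iff] using Finset.ext_iff.1 h i

theorem iterate_eq_of_word_eq (h : word ω v T = word ω' v T) {i : ℕ} (hi : i ≤ T) :
    (walk ω)^[i] v = (walk ω')^[i] v := by
  induction i with
  | zero => rfl
  | succ i ih =>
    have h_step := apply_iterate_eq_of_word_eq h hi
    rw [iterate_succ_apply', iterate_succ_apply', walk, walk, ← h_step, ih (by lia)]

theorem eq_of_word_eq_of_mem_trail (h : word ω v T = word ω' v T) {u : Torus n m}
    (hu : u ∈ trail ω v T) : ω u = ω' u := by
  obtain ⟨i, hi, rfl⟩ := Finset.mem_image.1 hu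
  have hi := Finset.mem_range.1 hi
  rw [apply_iterate_eq_of_word_eq h hi, iterate_eq_of_word_eq h hi.le]

theorem iterate_mul_eq_of_forall_word_eq {J W : ℕ} (h : ∀ j < J,
    word ω ((walk ω)^[j * W] v) W = word ω' ((walk ω')^[j * W] v) W) {j : ℕ} (hj : j ≤ J) :
    (walk ω)^[j * W] v = (walk ω')^[j * W] v := by
  induction j with
  | zero => simp
  | succ j ih =>
    have h_block := h j hj
    rw [← ih (by lia)] at h_block
    rw [Nat.succ_mul, add_comm, iterate_add_apply, iterate_add_apply, ← ih (by lia),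
      iterate_eq_of_word_eq h_block le_rfl]

theorem eq_of_forall_word_eq_of_mem_trail {J W : ℕ} (h : ∀ j < J,
    word ω ((walk ω)^[j * W] v) W = word ω' ((walk ω')^[j * W] v) W) {u : Torus n m}
    (hu : u ∈ trail ω v (J * W)) : ω u = ω' u := by
  obtain ⟨i, hi, rfl⟩ := Finset.mem_image.1 hu
  rw [Finset.mem_range] at hi
  have hW : 0 < W := Nat.pos_of_ne_zero fun hW => by simp [hW] at hi
  have hj : i / W < J := (Nat.div_lt_iff_lt_mul hW).2 hi
  have h_block := h (i / W) hj
  rw [← iterate_mul_eq_of_forall_word_eq h hj.le] at h_block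
  refine eq_of_word_eq_of_mem_trail h_block (Finset.mem_image.2
    ⟨i % W, Finset.mem_range.2 (Nat.mod_lt i hW), ?_⟩)
  rw [← iterate_add_apply, Nat.mod_add_div']

theorem law_real_selfAvoiding_and_steps_eq_le (v : Torus n m) (T j : ℕ) :
    (law n m).real {ω | SelfAvoiding ω v T ∧ steps ω v true T = j} ≤ coinProb T j := by
  refine (law_real_le_card_mul (fun ω => word ω v T) ((Finset.range T).powersetCard j)
    (fun ω => trail ω v T) (N := T) (fun ω hω => ?_) (fun ω hω => hω.1.card_trail.ge)
    fun ω _ ω' _ h u hu => eq_of_word_eq_of_mem_trail h hu).trans_eq ?_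
  · exact Finset.mem_powersetCard.2
      ⟨Finset.mem_powerset.1 word_mem_powerset, card_word.trans hω.2⟩
  · rw [Finset.card_powersetCard, Finset.card_range, coinProb, one_div, inv_pow, div_eq_mul_inv]

theorem law_real_selfAvoiding_and_forall_steps_notMem_le (v : Torus n m) {W : ℕ} {A : Finset ℕ}
    {δ : ℝ} (hδ : δ ≤ ∑ j ∈ A, coinProb W j) (J : ℕ) :
    (law n m).real {ω | SelfAvoiding ω v (J * W) ∧
      ∀ j < J, steps ω ((walk ω)^[j * W] v) true W ∉ A} ≤ (1 - δ) ^ J := by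
  refine (law_real_le_card_mul (fun ω (j : Fin J) => word ω ((walk ω)^[j * W] v) W)
    (Fintype.piFinset fun _ => (Finset.range W).powerset.filter fun B => B.card ∉ A)
    (fun ω => trail ω v (J * W)) (N := J * W) (fun ω hω => ?_) (fun ω hω => hω.1.card_trail.ge)
    fun ω _ ω' _ h u hu => eq_of_forall_word_eq_of_mem_trail
      (fun j hj => congr_fun h ⟨j, hj⟩) hu).trans ?_
  · refine Fintype.mem_piFinset.2 fun j => Finset.mem_filter.2 ⟨word_mem_powerset, ?_⟩
    rw [card_word]
    exact hω.2 j j.2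
  · rw [Fintype.card_piFinset_const, Nat.cast_pow, mul_comm J, pow_mul, ← mul_pow]
    refine pow_le_pow_left₀ (by positivity) ?_ J
    rw [one_div, inv_pow, ← div_eq_mul_inv, div_le_iff₀ (by positivity)]
    exact card_filter_powerset_card_notMem W hδ

end Exploration

section OffDiagonal

open Function

variable {n m : ℕ}

theorem forall_steps_notMem_Iic_or_Icc [NeZero n] {ω : Config n m} {v : Torus n m} {J : ℕ}
    (h : SelfAvoiding ω v (J * (n + m) + 1)) :
    (∀ j < J, steps ω ((walk ω)^[j * (n + m)] v) true (n + m) ∉ Finset.Iic n) ∨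
      ∀ j < J, steps ω ((walk ω)^[j * (n + m)] v) true (n + m) ∉ Finset.Icc n (n + m) := by
  rcases J with _ | J
  · simp
  have h_start : ∀ j < J + 1, j * (n + m) ≤ J * (n + m) := fun j hj =>
    Nat.mul_le_mul_right _ (by lia)
  rcases exists_steps_iterate_eq_or ω v true (n + m) n (J * (n + m)) with ⟨t, ht, h_eq⟩ | hlt | hgt
  · have h_return := isPeriodicPt_of_steps_eq h_eq
    rw [IsPeriodicPt, IsFixedPt, ← iterate_add_apply] at h_return
    have h_times := h (show n + m + t < (J + 1) * (n + m) + 1 by linarith)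
      (show t < (J + 1) * (n + m) + 1 by linarith) h_return
    have := NeZero.pos n
    lia
  · exact .inr fun j hj h_mem =>
      (hlt _ (h_start j hj)).not_ge (Finset.mem_Icc.1 h_mem).1
  · exact .inl fun j hj h_mem => (hgt _ (h_start j hj)).not_ge (Finset.mem_Iic.1 h_mem)

theorem law_real_selfAvoiding_le [NeZero n] (v : Torus n m) {δ : ℝ}
    (h_low : δ ≤ ∑ j ∈ Finset.Iic n, coinProb (n + m) j)
    (h_high : δ ≤ ∑ j ∈ Finset.Icc n (n + m), coinProb (n + m) j) (J : ℕ) :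
    (law n m).real {ω | SelfAvoiding ω v (J * (n + m) + 1)} ≤ 2 * (1 - δ) ^ J := by
  have h_cover : {ω : Config n m | SelfAvoiding ω v (J * (n + m) + 1)} ⊆
      {ω | SelfAvoiding ω v (J * (n + m)) ∧
        ∀ j < J, steps ω ((walk ω)^[j * (n + m)] v) true (n + m) ∉ Finset.Iic n} ∪
      {ω | SelfAvoiding ω v (J * (n + m)) ∧
        ∀ j < J, steps ω ((walk ω)^[j * (n + m)] v) true (n + m) ∉ Finset.Icc n (n + m)} :=
    fun ω hω => (forall_steps_notMem_Iic_or_Icc hω).imp (⟨hω.mono (Nat.le_succ _), ·⟩)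
      (⟨hω.mono (Nat.le_succ _), ·⟩)
  rw [two_mul]
  exact (measureReal_mono h_cover).trans ((measureReal_union_le _ _).trans (add_le_add
    (law_real_selfAvoiding_and_forall_steps_notMem_le v h_low J)
    (law_real_selfAvoiding_and_forall_steps_notMem_le v h_high J)))

theorem law_real_selfAvoiding_and_steps_eq_mul_le (v : Torus n m) {p q : ℕ}
    (h : p * n + q * m ≠ 0) :
    (law n m).real {ω | SelfAvoiding ω v (p * n + q * m) ∧
        steps ω v true (p * n + q * m) = p * n}
      ≤ Real.exp (-((p * n - q * m : ℝ) ^ 2 / (2 * (p * n + q * m)))) := by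
  refine (law_real_selfAvoiding_and_steps_eq_le v _ _).trans ((coinProb_le_exp h _).trans_eq ?_)
  push_cast
  ring_nf

/-- The configurations having a closed orbit whose homology class `(p, q)` satisfies `p ≠ q`: such
an orbit makes `p * n` right steps and `q * m` up steps. -/
def offDiagonal (n m : ℕ) : Set (Config n m) :=
  {ω | ∃ v ∈ periodicPts (walk ω), n * steps ω v false (minimalPeriod (walk ω) v)
    ≠ m * steps ω v true (minimalPeriod (walk ω) v)}

theorem minimalPeriod_and_hasHomologyClass_of_notMem_offDiagonal [NeZero n] [NeZero m]
    {ω : Config n m} (h : ω ∉ offDiagonal n m) {v : Torus n m} (hv : v ∈ periodicPts (walk ω)) :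
    minimalPeriod (walk ω) v = n + m ∧
      HasHomologyClass ω {w | w ∈ periodicOrbit (walk ω) v} 1 1 := by
  have h_steps := minimalPeriod_of_mul_steps_eq hv (by_contra fun h_ne => h ⟨v, hv, h_ne⟩)
  exact ⟨h_steps.1, hasHomologyClass_one_one_iff.2 h_steps⟩

theorem exists_selfAvoiding_of_mem_offDiagonal {ω : Config n m} (h : ω ∈ offDiagonal n m)
    (J : ℕ) : ∃ v, SelfAvoiding ω v (J * (n + m) + 1) ∨
      ∃ p q : ℕ, p ≠ q ∧ p * n + q * m ≤ J * (n + m) ∧ SelfAvoiding ω v (p * n + q * m) ∧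
        steps ω v true (p * n + q * m) = p * n := by
  obtain ⟨v, -, h_ne⟩ := h
  refine ⟨v, ?_⟩
  have h_avoid : SelfAvoiding ω v (minimalPeriod (walk ω) v) := iterate_injOn_Iio_minimalPeriod
  rcases Nat.lt_or_ge (J * (n + m)) (minimalPeriod (walk ω) v) with h_long | h_short
  · exact .inl (h_avoid.mono h_long)
  have h_fix : (walk ω)^[minimalPeriod (walk ω) v] v = v := iterate_minimalPeriod
  rw [iterate_walk, Prod.ext_iff] at h_fix
  simp only [add_eq_left, ZMod.natCast_eq_zero_iff] at h_fix
  obtain ⟨⟨p, hp⟩, q, hq⟩ := h_fix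
  have h_period : minimalPeriod (walk ω) v = p * n + q * m := by
    rw [← steps_true_add_steps_false ω v (minimalPeriod (walk ω) v), hp, hq]
    ring
  refine .inr ⟨p, q, ?_, h_period ▸ h_short, h_period ▸ h_avoid, ?_⟩
  · rintro rfl
    exact h_ne (by rw [hp, hq]; ring)
  · rw [← h_period, hp, mul_comm]

theorem law_real_exists_steps_eq_mul_le [NeZero n] [NeZero m] (hmn : m ≤ 2 * n)
    (hnm : n ≤ 2 * m) (v : Torus n m) {J : ℕ} {e : ℝ} (he0 : 0 ≤ e)
    (he : ∀ p q : ℕ, p ≠ q → p * n + q * m ≤ J * (n + m) →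
      Real.exp (-((p * n - q * m : ℝ) ^ 2 / (2 * (p * n + q * m)))) ≤ e) :
    (law n m).real {ω | ∃ p q : ℕ, p ≠ q ∧ p * n + q * m ≤ J * (n + m) ∧
        SelfAvoiding ω v (p * n + q * m) ∧ steps ω v true (p * n + q * m) = p * n}
      ≤ (3 * J + 1) ^ 2 * e := by
  classical
  have hn := NeZero.pos n
  have hm := NeZero.pos m
  set classes := (Finset.range (3 * J + 1) ×ˢ Finset.range (3 * J + 1)).filter
    fun x => x.1 ≠ x.2 ∧ x.1 * n + x.2 * m ≤ J * (n + m)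
  have h_cover : {ω : Config n m | ∃ p q : ℕ, p ≠ q ∧ p * n + q * m ≤ J * (n + m) ∧
        SelfAvoiding ω v (p * n + q * m) ∧ steps ω v true (p * n + q * m) = p * n} ⊆
      ⋃ x ∈ classes, {ω | SelfAvoiding ω v (x.1 * n + x.2 * m) ∧
        steps ω v true (x.1 * n + x.2 * m) = x.1 * n} := by
    rintro ω ⟨p, q, hpq, h_le, hω⟩
    simp only [Set.mem_iUnion]
    refine ⟨(p, q), Finset.mem_filter.2 ⟨Finset.mk_mem_product (Finset.mem_range.2 ?_)
      (Finset.mem_range.2 ?_), hpq, h_le⟩, hω⟩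
    · exact Nat.lt_succ_of_le (Nat.le_of_mul_le_mul_right (by nlinarith : p * n ≤ 3 * J * n) hn)
    · exact Nat.lt_succ_of_le (Nat.le_of_mul_le_mul_right (by nlinarith : q * m ≤ 3 * J * m) hm)
  have h_class : ∀ x ∈ classes, (law n m).real {ω | SelfAvoiding ω v (x.1 * n + x.2 * m) ∧
      steps ω v true (x.1 * n + x.2 * m) = x.1 * n} ≤ e := fun x hx => by
    obtain ⟨-, hpq, h_le⟩ := Finset.mem_filter.1 hx
    refine (law_real_selfAvoiding_and_steps_eq_mul_le v fun h0 => hpq ?_).trans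
      (he x.1 x.2 hpq h_le)
    simp only [Nat.add_eq_zero_iff, Nat.mul_eq_zero, hn.ne', hm.ne', or_false] at h0
    rw [h0.1, h0.2]
  have h_card : (classes.card : ℝ) ≤ (3 * J + 1) ^ 2 := by
    have : classes.card ≤ (3 * J + 1) ^ 2 := (Finset.card_filter_le _ _).trans_eq
      (by rw [Finset.card_product, Finset.card_range, sq])
    exact_mod_cast this
  refine (measureReal_mono h_cover (measure_ne_top _ _)).trans
    ((measureReal_biUnion_finset_le _ _).trans ((Finset.sum_le_card_nsmul _ _ _ h_class).trans ?_))
  rw [nsmul_eq_mul]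
  exact mul_le_mul_of_nonneg_right h_card he0

theorem law_real_offDiagonal_le [NeZero n] [NeZero m] (hmn : m ≤ 2 * n) (hnm : n ≤ 2 * m)
    {J : ℕ} {δ e : ℝ} (h_low : δ ≤ ∑ j ∈ Finset.Iic n, coinProb (n + m) j)
    (h_high : δ ≤ ∑ j ∈ Finset.Icc n (n + m), coinProb (n + m) j) (he0 : 0 ≤ e)
    (he : ∀ p q : ℕ, p ≠ q → p * n + q * m ≤ J * (n + m) →
      Real.exp (-((p * n - q * m : ℝ) ^ 2 / (2 * (p * n + q * m)))) ≤ e) :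
    (law n m).real (offDiagonal n m)
      ≤ n * m * (2 * (1 - δ) ^ J + (3 * J + 1) ^ 2 * e) := by
  have h_cover : offDiagonal n m ⊆ ⋃ v ∈ (Finset.univ : Finset (Torus n m)),
      ({ω | SelfAvoiding ω v (J * (n + m) + 1)} ∪ {ω | ∃ p q : ℕ, p ≠ q ∧
        p * n + q * m ≤ J * (n + m) ∧ SelfAvoiding ω v (p * n + q * m) ∧
          steps ω v true (p * n + q * m) = p * n}) := fun ω hω => by
    simpa using exists_selfAvoiding_of_mem_offDiagonal hω J
  have h_card : ((Finset.univ : Finset (Torus n m)).card : ℝ) = n * m := by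
    rw [Finset.card_univ, Fintype.card_prod, ZMod.card, ZMod.card]; push_cast; rfl
  rw [← h_card, ← nsmul_eq_mul]
  refine (measureReal_mono h_cover (measure_ne_top _ _)).trans
    ((measureReal_biUnion_finset_le _ _).trans (Finset.sum_le_card_nsmul _ _ _ fun v _ => ?_))
  exact (measureReal_union_le _ _).trans (add_le_add (law_real_selfAvoiding_le v h_low h_high J)
    (law_real_exists_steps_eq_mul_le hmn hnm v he0 he))

end OffDiagonal

section UpperTail

open Function

variable {n m : ℕ}

open Classical in
/-- The ordinates `y` such that the edge from `(0, y)` to `(1, y)` belongs to a closed orbit of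
homology class `(1, 1)`. Every such orbit has exactly one such edge, so these ordinates label the
orbits counted by `numCycles 1 1 ω`. -/
noncomputable def exits [NeZero m] (ω : Config n m) : Finset (ZMod m) :=
  Finset.univ.filter fun y => ((0, y) : Torus n m) ∈ periodicPts (walk ω) ∧ ω (0, y) = true ∧
    HasHomologyClass ω {w | w ∈ periodicOrbit (walk ω) (0, y)} 1 1

theorem mem_exits [NeZero m] {ω : Config n m} {y : ZMod m} :
    y ∈ exits ω ↔ ((0, y) : Torus n m) ∈ periodicPts (walk ω) ∧ ω (0, y) = true ∧
      HasHomologyClass ω {w | w ∈ periodicOrbit (walk ω) (0, y)} 1 1 := by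
  simp [exits]

theorem numCycles_le_card_exits [NeZero m] (ω : Config n m) :
    numCycles 1 1 ω ≤ (exits ω).card := by
  set orbit : ZMod m → Set (Torus n m) := fun y => {w | w ∈ periodicOrbit (walk ω) (0, y)}
  suffices h_sub : {C | IsClosedOrbit ω C ∧ HasHomologyClass ω C 1 1} ⊆ orbit '' exits ω by
    rw [← Set.ncard_coe_finset]
    exact (Set.ncard_le_ncard h_sub ((exits ω).finite_toSet.image _)).trans
      (Set.ncard_image_le (exits ω).finite_toSet)
  rintro C ⟨⟨v, hv, rfl⟩, hC⟩
  obtain ⟨⟨x, y⟩, hu, rfl, h_right⟩ :=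
    Set.nonempty_of_ncard_ne_zero ((hC.1 0).trans_ne one_ne_zero)
  obtain ⟨i, hi⟩ := (mem_periodicOrbit_iff hv).1 hu
  have h_orbit : periodicOrbit (walk ω) (0, y) = periodicOrbit (walk ω) v := by
    rw [← hi, periodicOrbit_apply_iterate_eq hv]
  have h_periodic : (0, y) ∈ periodicPts (walk ω) := by
    obtain ⟨k, hk, hkv⟩ := hv
    exact ⟨k, hk, hi ▸ hkv.apply_iterate i⟩
  refine ⟨y, mem_exits.2 ⟨h_periodic, h_right, ?_⟩, ?_⟩
  · rwa [h_orbit]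
  · simp only [orbit, h_orbit]

theorem eq_of_mem_exits [NeZero m] {ω : Config n m} {y y' : ZMod m} (hy : y ∈ exits ω)
    (hy' : y' ∈ exits ω) {i j : ℕ} (h : (walk ω)^[i] (0, y) = (walk ω)^[j] (0, y')) : y = y' := by
  rw [mem_exits] at hy hy'
  have h_orbit : periodicOrbit (walk ω) ((0, y) : Torus n m) = periodicOrbit (walk ω) (0, y') := by
    rw [← periodicOrbit_apply_iterate_eq hy.1 i, h, periodicOrbit_apply_iterate_eq hy'.1]
  obtain ⟨a, ha⟩ := Set.ncard_eq_one.1 (hy.2.2.1 0)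
  have h_mem : ((0, y) : Torus n m) ∈ ({a} : Set (Torus n m)) :=
    ha ▸ ⟨self_mem_periodicOrbit hy.1, rfl, hy.2.1⟩
  have h_mem' : ((0, y') : Torus n m) ∈ ({a} : Set (Torus n m)) :=
    ha ▸ ⟨Set.mem_ofPred_eq ▸ h_orbit ▸ self_mem_periodicOrbit hy'.1, rfl, hy'.2.1⟩
  exact congr_arg Prod.snd (h_mem.trans h_mem'.symm)

variable [NeZero n] [NeZero m]

theorem minimalPeriod_and_steps_of_mem_exits {ω : Config n m} {y : ZMod m} (hy : y ∈ exits ω) :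
    minimalPeriod (walk ω) (0, y) = n + m ∧ steps ω (0, y) true (n + m) = n :=
  hasHomologyClass_one_one_iff.1 (mem_exits.1 hy).2.2

theorem law_real_subset_exits_le (B : Finset (ZMod m)) :
    (law n m).real {ω | B ⊆ exits ω} ≤ coinProb (n + m) n ^ B.card := by
  classical
  refine (law_real_le_card_mul (fun ω (y : B) => word ω (0, (y : ZMod m)) (n + m))
    (Fintype.piFinset fun _ => (Finset.range (n + m)).powersetCard n)
    (fun ω => B.biUnion fun y => trail ω (0, y) (n + m)) (N := (n + m) * B.card)
    (fun ω hω => ?_) (fun ω hω => ?_) fun ω _ ω' _ h u hu => ?_).trans_eq ?_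
  · exact Fintype.mem_piFinset.2 fun y => Finset.mem_powersetCard.2
      ⟨Finset.mem_powerset.1 word_mem_powerset,
        card_word.trans (minimalPeriod_and_steps_of_mem_exits (hω y.2)).2⟩
  · rw [Finset.card_biUnion fun y hy y' hy' h_ne => Finset.disjoint_left.2 fun u hu hu' => ?_]
    · refine (mul_comm _ _).trans_le (Finset.card_nsmul_le_sum _ _ _ fun y hy => ?_)
      have h_avoid : SelfAvoiding ω (0, y) (minimalPeriod (walk ω) (0, y)) :=
        iterate_injOn_Iio_minimalPeriod
      rw [(minimalPeriod_and_steps_of_mem_exits (hω hy)).1] at h_avoid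
      exact h_avoid.card_trail.ge
    · obtain ⟨i, -, rfl⟩ := Finset.mem_image.1 hu
      obtain ⟨j, -, h⟩ := Finset.mem_image.1 hu'
      exact h_ne (eq_of_mem_exits (hω hy) (hω hy') h.symm)
  · obtain ⟨y, hy, hu⟩ := Finset.mem_biUnion.1 hu
    exact eq_of_word_eq_of_mem_trail (congr_fun h ⟨y, hy⟩) hu
  · rw [Fintype.card_piFinset, Finset.prod_const, Finset.card_univ, Fintype.card_coe,
      Finset.card_powersetCard, Finset.card_range, coinProb, pow_mul, Nat.cast_pow, ← mul_pow,
      one_div, inv_pow, div_eq_mul_inv]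

theorem integral_two_pow_card_exits_le :
    ∫ ω, (2 : ℝ) ^ (exits ω).card ∂law n m ≤ Real.exp (m * coinProb (n + m) n) := by
  classical
  have h_pow : ∀ ω : Config n m, (2 : ℝ) ^ (exits ω).card =
      ∑ B : Finset (ZMod m), {ω | B ⊆ exits ω}.indicator 1 ω := fun ω => by
    simp only [Set.indicator_apply, Set.mem_ofPred_eq, Pi.one_apply, Finset.sum_boole,
      Finset.filter_subset_univ, Finset.card_powerset, Nat.cast_pow, Nat.cast_ofNat]
  calc ∫ ω, (2 : ℝ) ^ (exits ω).card ∂law n m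
      = ∑ B : Finset (ZMod m), (law n m).real {ω | B ⊆ exits ω} := by
        simp only [h_pow]
        rw [integral_finsetSum _ fun _ _ => .of_finite]
        exact Finset.sum_congr rfl fun B _ => integral_indicator_one (Set.toFinite _).measurableSet
    _ ≤ ∑ B : Finset (ZMod m), coinProb (n + m) n ^ B.card * 1 ^ (m - B.card) :=
        Finset.sum_le_sum fun B _ => by simpa using law_real_subset_exits_le B
    _ = (coinProb (n + m) n + 1) ^ m := by
        simpa using Finset.sum_pow_mul_eq_add_pow (coinProb (n + m) n) 1 (Finset.univ (α := ZMod m))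
    _ ≤ Real.exp (coinProb (n + m) n) ^ m :=
        pow_le_pow_left₀ (add_nonneg (coinProb_nonneg _ _) zero_le_one) (Real.add_one_le_exp _) m
    _ = Real.exp (m * coinProb (n + m) n) := (Real.exp_nat_mul _ _).symm

theorem law_real_lt_numCycles_le (x : ℝ) :
    (law n m).real {ω | x < (numCycles 1 1 ω : ℝ)}
      ≤ Real.exp (m * coinProb (n + m) n - x * Real.log 2) := by
  have h_two_pow : ∀ ω : Config n m, x < numCycles 1 1 ω →
      Real.exp (x * Real.log 2) ≤ 2 ^ (exits ω).card := fun ω hω => by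
    rw [mul_comm, ← Real.rpow_def_of_pos two_pos, ← Real.rpow_natCast]
    exact Real.rpow_le_rpow_of_exponent_le one_le_two
      (hω.le.trans (Nat.cast_le.2 (numCycles_le_card_exits ω)))
  have h_markov := mul_meas_ge_le_integral_of_nonneg (μ := law n m)
    (f := fun ω => (2 : ℝ) ^ (exits ω).card) (.of_forall fun _ => by positivity) .of_finite
    (Real.exp (x * Real.log 2))
  rw [Real.exp_sub, le_div_iff₀' (Real.exp_pos _)]
  exact (mul_le_mul_of_nonneg_left (measureReal_mono h_two_pow) (Real.exp_pos _).le).trans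
    (h_markov.trans integral_two_pow_card_exits_le)

end UpperTail

section MapMatrix

open Function

variable {V : Type*} [DecidableEq V]

/-- The transition matrix of the deterministic Markov chain which moves from `v` to `f v`. -/
def mapMatrix (f : V → V) : Matrix V V ℝ :=
  Matrix.of fun v w => if f v = w then 1 else 0

variable [Fintype V]

theorem mapMatrix_mul (f g : V → V) : mapMatrix f * mapMatrix g = mapMatrix (g ∘ f) := by
  ext v w
  simp only [mapMatrix, Matrix.mul_apply, Matrix.of_apply, ite_mul, one_mul, zero_mul,
    Finset.sum_ite_eq, Finset.mem_univ, if_true, comp_apply]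

theorem mapMatrix_pow (f : V → V) (k : ℕ) : mapMatrix f ^ k = mapMatrix f^[k] := by
  induction k with
  | zero => ext v w; rw [pow_zero, Matrix.one_apply]; rfl
  | succ k ih => rw [pow_succ, ih, mapMatrix_mul, iterate_succ']

theorem trace_mapMatrix (f : V → V) : (mapMatrix f).trace = (fixedPoints f).ncard := by
  have h_fixed : fixedPoints f = (Finset.univ.filter fun v => f v = v : Finset V) := by
    ext v
    simp [IsFixedPt]
  rw [h_fixed, Set.ncard_coe_finset]
  simp [mapMatrix, Matrix.trace]

theorem sum_abs_smul_mapMatrix {s : ℝ} (hs : 0 ≤ s) (f : V → V) (v : V) :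
    ∑ w, |(s • mapMatrix f) v w| = s := by
  simp [mapMatrix, abs_of_nonneg hs, apply_ite abs]

/-- The determinant is linear in each row, and the two sides of the identity have the same rows on
average. -/
theorem det_one_sub_smul_mapMatrix_add (f g : V → V) (s : ℝ) :
    (1 - s • (1 / 2 : ℝ) • (mapMatrix f + mapMatrix g)).det = ∑ ω : V → Bool,
      (1 / 2) ^ Fintype.card V *
        (1 - s • mapMatrix fun v => if ω v = true then f v else g v).det := by
  set row : V → Bool → V → ℝ := fun v b =>
    (1 - s • mapMatrix fun u => if b = true then f u else g u) v
  have h_rows : (1 - s • (1 / 2 : ℝ) • (mapMatrix f + mapMatrix g)) =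
      fun v => ∑ b : Bool, (1 / 2 : ℝ) • row v b := by
    ext v w
    simp only [row, mapMatrix, Fintype.sum_bool, Matrix.sub_apply, Matrix.smul_apply,
      Matrix.add_apply, Matrix.of_apply, Pi.add_apply, Pi.smul_apply, smul_eq_mul, if_true,
      Bool.false_eq_true, if_false]
    ring
  rw [h_rows]
  refine ((Matrix.detRowAlternating (R := ℝ)).toMultilinearMap.map_sum
    fun v b => (1 / 2 : ℝ) • row v b).trans (Finset.sum_congr rfl fun ω _ => ?_)
  rw [MultilinearMap.map_smul_univ _ (fun _ => (1 / 2 : ℝ)) fun v => row v (ω v),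
    Finset.prod_const, Finset.card_univ, smul_eq_mul]
  rfl

theorem det_one_sub_smul_mapMatrix_pos_and_hasSum {s : ℝ} (hs0 : 0 ≤ s) (hs1 : s < 1)
    (f : V → V) : 0 < (1 - s • mapMatrix f).det ∧
      HasSum (fun k : ℕ => s ^ k * (fixedPoints f^[k]).ncard / k)
        (-Real.log (1 - s • mapMatrix f).det) := by
  simpa only [smul_pow, Matrix.trace_smul, smul_eq_mul, mapMatrix_pow, trace_mapMatrix] using
    det_one_sub_pos_and_hasSum_trace_pow_div hs1 fun v => (sum_abs_smul_mapMatrix hs0 f v).le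

/-- In fact `det (1 - s • mapMatrix f)` is the product over the cycles of `f` of `1 - s ^ l`, where
`l` is the length of the cycle. -/
theorem one_sub_pow_pow_le_det_one_sub_smul_mapMatrix {s : ℝ} (hs0 : 0 ≤ s) (hs1 : s < 1)
    {f : V → V} {L N : ℕ} (hL : 0 < L) (h_period : ∀ v ∈ periodicPts f, minimalPeriod f v = L)
    (hN : (periodicPts f).ncard ≤ L * N) : (1 - s ^ L) ^ N ≤ (1 - s • mapMatrix f).det := by
  obtain ⟨h_pos, h_sum⟩ := det_one_sub_smul_mapMatrix_pos_and_hasSum hs0 hs1 f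
  have h_pow : s ^ L < 1 := pow_lt_one₀ hs0 hs1 hL.ne'
  suffices h_log : -Real.log (1 - s • mapMatrix f).det ≤ N * -Real.log (1 - s ^ L) by
    rw [← Real.log_le_log_iff (pow_pos (sub_pos.2 h_pow) N) h_pos, Real.log_pow]
    linarith
  have h_inj : Injective fun j : ℕ => L * (j + 1) := fun a b hab =>
    Nat.succ_injective (Nat.eq_of_mul_eq_mul_left hL hab)
  have h_log_sum := (Real.hasSum_pow_div_log_of_abs_lt_one
    ((abs_of_nonneg (pow_nonneg hs0 L)).trans_lt h_pow)).mul_left (N : ℝ)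
  refine hasSum_le (fun j => ?_) ((h_inj.hasSum_iff fun k hk => ?_).2 h_sum) h_log_sum
  · have h_card : (fixedPoints f^[L * (j + 1)]).ncard ≤ L * N :=
      (Set.ncard_le_ncard (fun v hv => mk_mem_periodicPts (by positivity) hv)).trans hN
    rw [comp_apply, pow_mul]
    calc (s ^ L) ^ (j + 1) * (fixedPoints f^[L * (j + 1)]).ncard / (L * (j + 1) : ℕ)
        ≤ (s ^ L) ^ (j + 1) * (L * N : ℕ) / (L * (j + 1) : ℕ) := by gcongr
      _ = N * ((s ^ L) ^ (j + 1) / (j + 1)) := by push_cast; field_simp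
  · rcases Nat.eq_zero_or_pos k with rfl | hk0
    · simp
    · have h_empty : fixedPoints f^[k] = ∅ := Set.eq_empty_of_forall_notMem fun v hv => hk <| by
        obtain ⟨j, rfl⟩ : L ∣ k :=
          h_period v (mk_mem_periodicPts hk0 hv) ▸ IsPeriodicPt.minimalPeriod_dvd hv
        obtain ⟨i, rfl⟩ := Nat.exists_eq_succ_of_ne_zero (Nat.pos_of_mul_pos_left hk0).ne'
        exact ⟨i, rfl⟩
      rw [h_empty]
      simp

end MapMatrix

section LowerTail

open Function

variable {n m : ℕ} [NeZero n] [NeZero m]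

/-- The transition matrix of the annealed random walk, which makes a fresh fair choice between a
right step and an up step at every time. -/
noncomputable def annealedMatrix (n m : ℕ) : Matrix (Torus n m) (Torus n m) ℝ :=
  (1 / 2 : ℝ) • (mapMatrix (· + (1, 0)) + mapMatrix (· + (0, 1)))

theorem integral_law (g : Config n m → ℝ) :
    ∫ ω, g ω ∂law n m = ∑ ω, (1 / 2) ^ Fintype.card (Torus n m) * g ω := by
  rw [integral_fintype .of_finite]
  refine Finset.sum_congr rfl fun ω _ => ?_
  rw [smul_eq_mul, ← Finset.card_univ, ← law_real_cylinder Finset.univ ω]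
  congr
  ext ω'
  simp [funext_iff]

theorem integral_det_one_sub_smul_mapMatrix_walk (s : ℝ) :
    ∫ ω, (1 - s • mapMatrix (walk ω)).det ∂law n m = (1 - s • annealedMatrix n m).det := by
  have h_walk : ∀ ω : Config n m,
      walk ω = fun v => if ω v = true then v + (1, 0) else v + (0, 1) := fun ω => by
    ext v <;> simp only [walk] <;> split_ifs <;> simp
  simp only [integral_law, annealedMatrix, det_one_sub_smul_mapMatrix_add, h_walk]

theorem ncard_fixedPoints_add_right_iterate_comp (i j : ℕ) :
    (fixedPoints ((· + ((0, 1) : Torus n m))^[j] ∘ (· + ((1, 0) : Torus n m))^[i])).ncard =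
      if n ∣ i ∧ m ∣ j then n * m else 0 := by
  have h_fixed : fixedPoints ((· + ((0, 1) : Torus n m))^[j] ∘ (· + ((1, 0) : Torus n m))^[i]) =
      {_v | n ∣ i ∧ m ∣ j} := by
    ext v
    simp [add_right_iterate, IsFixedPt, Prod.ext_iff, ZMod.natCast_eq_zero_iff]
  rw [h_fixed]
  split_ifs with h <;> simp [h, Set.ncard_univ]

theorem trace_annealedMatrix_pow (k : ℕ) : (annealedMatrix n m ^ k).trace =
    n * m * ∑ j ∈ Finset.range (k + 1) with n ∣ j ∧ m ∣ k - j, coinProb k j := by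
  have h_comm : Commute (mapMatrix (· + ((1, 0) : Torus n m)))
      (mapMatrix (· + ((0, 1) : Torus n m))) := by
    rw [Commute, SemiconjBy, mapMatrix_mul, mapMatrix_mul]
    congr 1
    ext v <;> simp [add_right_comm]
  rw [annealedMatrix, smul_pow, h_comm.add_pow, Matrix.trace_smul, Matrix.trace_sum, smul_eq_mul,
    Finset.mul_sum, Finset.sum_filter, Finset.mul_sum]
  refine Finset.sum_congr rfl fun j _ => ?_
  rw [mapMatrix_pow, mapMatrix_pow, mapMatrix_mul, ← nsmul_eq_mul', Matrix.trace_smul,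
    trace_mapMatrix, ncard_fixedPoints_add_right_iterate_comp, nsmul_eq_mul, coinProb,
    one_div, inv_pow]
  split_ifs
  · push_cast
    ring
  · simp

theorem mul_coinProb_le_trace_annealedMatrix_pow :
    n * m * coinProb (n + m) n ≤ (annealedMatrix n m ^ (n + m)).trace := by
  rw [trace_annealedMatrix_pow]
  gcongr
  exact Finset.single_le_sum (f := coinProb (n + m)) (fun j _ => coinProb_nonneg _ _) (by simp)

theorem det_one_sub_smul_annealedMatrix_le {s : ℝ} (hs0 : 0 ≤ s) (hs1 : s < 1) :
    (1 - s • annealedMatrix n m).det ≤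
      Real.exp (-(s ^ (n + m) * (n * m * coinProb (n + m) n) / (n + m))) := by
  have h_row : ∀ v, ∑ w, |(s • annealedMatrix n m) v w| ≤ s := fun v => by
    calc ∑ w, |(s • annealedMatrix n m) v w|
        = 1 / 2 * ∑ w, |(s • mapMatrix (· + ((1, 0) : Torus n m))) v w +
            (s • mapMatrix (· + ((0, 1) : Torus n m))) v w| := by
          rw [Finset.mul_sum]
          refine Finset.sum_congr rfl fun w _ => ?_
          rw [annealedMatrix, smul_comm, smul_add, Matrix.smul_apply, Matrix.add_apply,
            smul_eq_mul, abs_mul, abs_of_nonneg one_half_pos.le]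
      _ ≤ 1 / 2 * (∑ w, |(s • mapMatrix (· + ((1, 0) : Torus n m))) v w| +
            ∑ w, |(s • mapMatrix (· + ((0, 1) : Torus n m))) v w|) := by
          rw [← Finset.sum_add_distrib]
          gcongr
          exact abs_add_le _ _
      _ = s := by
          rw [sum_abs_smul_mapMatrix hs0, sum_abs_smul_mapMatrix hs0]
          ring
  obtain ⟨h_pos, h_sum⟩ := det_one_sub_pos_and_hasSum_trace_pow_div hs1 h_row
  rw [← Real.log_le_iff_le_exp h_pos, le_neg]
  simp only [smul_pow, Matrix.trace_smul, smul_eq_mul] at h_sum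
  refine le_trans ?_ (le_hasSum h_sum (n + m) fun k _ => ?_)
  · push_cast
    gcongr
    exact mul_coinProb_le_trace_annealedMatrix_pow
  · rw [trace_annealedMatrix_pow]
    have h_nonneg (S : Finset ℕ) : 0 ≤ ∑ j ∈ S, coinProb k j :=
      Finset.sum_nonneg fun j _ => coinProb_nonneg k j
    exact div_nonneg (mul_nonneg (by positivity) (mul_nonneg (by positivity) (h_nonneg _)))
      (Nat.cast_nonneg k)

theorem ncard_periodicPts_le {ω : Config n m} (h : ω ∉ offDiagonal n m) :
    (periodicPts (walk ω)).ncard ≤ (n + m) * numCycles 1 1 ω := by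
  classical
  set orbit : Torus n m → Set (Torus n m) := fun v => {w | w ∈ periodicOrbit (walk ω) v}
  set s := (periodicPts (walk ω)).toFinite.toFinset
  have h_mem : ∀ {v}, v ∈ s ↔ v ∈ periodicPts (walk ω) := Set.Finite.mem_toFinset _
  have h_image : (s.image orbit : Set (Set (Torus n m))) ⊆
      {C | IsClosedOrbit ω C ∧ HasHomologyClass ω C 1 1} := fun C hC => by
    obtain ⟨v, hv, rfl⟩ := Finset.mem_image.1 (Finset.mem_coe.1 hC)
    exact ⟨⟨v, h_mem.1 hv, rfl⟩,
      (minimalPeriod_and_hasHomologyClass_of_notMem_offDiagonal h (h_mem.1 hv)).2⟩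
  have h_fiber : ∀ C ∈ s.image orbit, (s.filter fun x => orbit x = C).card ≤ n + m := fun C hC => by
    obtain ⟨v, hv, rfl⟩ := Finset.mem_image.1 hC
    have h_ncard : (orbit v).ncard = n + m := by
      have h_all := ncard_periodicOrbit_inter (walk ω) v fun _ => True
      simp only [and_true, Finset.filter_true, Finset.card_range] at h_all
      exact h_all.trans
        (minimalPeriod_and_hasHomologyClass_of_notMem_offDiagonal h (h_mem.1 hv)).1
    rw [← h_ncard, ← Set.ncard_coe_finset]
    refine Set.ncard_le_ncard fun x hx => ?_
    obtain ⟨hx, hxv⟩ := Finset.mem_filter.1 hx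
    exact hxv ▸ self_mem_periodicOrbit (h_mem.1 hx)
  rw [Set.ncard_eq_toFinset_card]
  refine (Finset.card_le_mul_card_image s (n + m) h_fiber).trans (Nat.mul_le_mul_left _ ?_)
  rw [← Set.ncard_coe_finset]
  exact Set.ncard_le_ncard h_image

theorem law_real_numCycles_le (x : ℝ) :
    (law n m).real {ω | ω ∉ offDiagonal n m ∧ (numCycles 1 1 ω : ℝ) ≤ x}
      ≤ Real.exp (x * Real.log 2 - n * m * coinProb (n + m) n / (2 * (n + m))) := by
  have h_pos : 0 < n + m := Nat.add_pos_left (NeZero.pos n) m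
  obtain ⟨s, hs0, hs1, hs⟩ : ∃ s : ℝ, 0 ≤ s ∧ s < 1 ∧ s ^ (n + m) = 1 / 2 :=
    ⟨(1 / 2) ^ ((n + m : ℕ) : ℝ)⁻¹, by positivity, Real.rpow_lt_one (by norm_num) (by norm_num)
      (by positivity), Real.rpow_inv_natCast_pow (by norm_num) h_pos.ne'⟩
  have h_le_det : ∀ ω : Config n m, ω ∉ offDiagonal n m ∧ (numCycles 1 1 ω : ℝ) ≤ x →
      Real.exp (-(x * Real.log 2)) ≤ (1 - s • mapMatrix (walk ω)).det := fun ω ⟨hω, hx⟩ =>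
    calc Real.exp (-(x * Real.log 2)) ≤ Real.exp (numCycles 1 1 ω * -Real.log 2) := by
          rw [mul_neg]
          gcongr
      _ = (1 - s ^ (n + m)) ^ numCycles 1 1 ω := by
          rw [Real.exp_nat_mul, Real.exp_neg, Real.exp_log two_pos, hs]
          norm_num
      _ ≤ (1 - s • mapMatrix (walk ω)).det :=
          one_sub_pow_pow_le_det_one_sub_smul_mapMatrix hs0 hs1 h_pos (fun v hv =>
            (minimalPeriod_and_hasHomologyClass_of_notMem_offDiagonal hω hv).1)
            (ncard_periodicPts_le hω)
  have h_markov := mul_meas_ge_le_integral_of_nonneg (μ := law n m)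
    (f := fun ω => (1 - s • mapMatrix (walk ω)).det)
    (.of_forall fun ω => (det_one_sub_smul_mapMatrix_pos_and_hasSum hs0 hs1 (walk ω)).1.le)
    .of_finite (Real.exp (-(x * Real.log 2)))
  have h_annealed := det_one_sub_smul_annealedMatrix_le (n := n) (m := m) hs0 hs1
  rw [← integral_det_one_sub_smul_mapMatrix_walk, hs] at h_annealed
  have h_mul := (mul_le_mul_of_nonneg_left (measureReal_mono (μ := law n m) h_le_det)
    (Real.exp_pos _).le).trans (h_markov.trans h_annealed)
  rw [Real.exp_neg, inv_mul_le_iff₀ (Real.exp_pos _), ← Real.exp_add] at h_mul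
  exact h_mul.trans_eq (by congr 1; field_simp; ring)

end LowerTail

section Rates

theorem eventually_mul_pow_mul_exp_le (A : ℝ) (k : ℕ) {a b : ℝ} (hba : b < a) :
    ∀ᶠ n : ℕ in atTop, A * (n : ℝ) ^ k * Real.exp (-(a * √n)) ≤ Real.exp (-(b * √n)) := by
  have h_sqrt : Tendsto (fun n : ℕ => √(n : ℝ)) atTop atTop :=
    Real.tendsto_sqrt_atTop.comp tendsto_natCast_atTop_atTop
  have h_littleO := ((isLittleO_pow_exp_pos_mul_atTop (2 * k) (sub_pos.2 hba)).comp_tendsto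
    h_sqrt).const_mul_left A
  filter_upwards [h_littleO.def one_pos] with n hn
  have h_le : A * (n : ℝ) ^ k ≤ Real.exp ((a - b) * √n) := by
    simpa [pow_mul, Real.sq_sqrt] using (le_abs_self _).trans hn
  calc A * (n : ℝ) ^ k * Real.exp (-(a * √n))
      ≤ Real.exp ((a - b) * √n) * Real.exp (-(a * √n)) := by gcongr
    _ = Real.exp (-(b * √n)) := by
      rw [← Real.exp_add]
      ring_nf

theorem one_sub_pow_floor_le {δ : ℝ} (hδ0 : 0 ≤ δ) (hδ1 : δ ≤ 1) (x : ℝ) :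
    (1 - δ) ^ ⌊x⌋₊ ≤ 3 * Real.exp (-(δ * x)) := by
  calc (1 - δ) ^ ⌊x⌋₊ ≤ Real.exp (-δ) ^ ⌊x⌋₊ :=
        pow_le_pow_left₀ (by linarith) (Real.one_sub_le_exp_neg δ) _
    _ = Real.exp (⌊x⌋₊ * -δ) := (Real.exp_nat_mul _ _).symm
    _ ≤ Real.exp (1 + -(δ * x)) := by
      gcongr
      nlinarith [Nat.lt_floor_add_one x]
    _ ≤ 3 * Real.exp (-(δ * x)) := by
      rw [Real.exp_add]
      gcongr
      exact Real.exp_one_lt_three.le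

theorem eventually_le_two_mul_of_abs_sub_le (σ : ℝ) : ∀ᶠ n : ℕ in atTop, ∀ m : ℕ,
    |(m : ℝ) - n| ≤ σ * √n → n ≤ 2 * m ∧ m ≤ 2 * n := by
  have h_sqrt : ∀ᶠ n : ℕ in atTop, 2 * σ ≤ √(n : ℝ) :=
    (Real.tendsto_sqrt_atTop.comp tendsto_natCast_atTop_atTop).eventually_ge_atTop _
  filter_upwards [h_sqrt] with n hn m hm
  have h_half : σ * √n ≤ n / 2 := by
    nlinarith [Real.mul_self_sqrt (n.cast_nonneg (α := ℝ)), Real.sqrt_nonneg (n : ℝ)]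
  rw [abs_le] at hm
  constructor
  · exact_mod_cast (by linarith : (n : ℝ) ≤ 2 * m)
  · exact_mod_cast (by linarith [n.cast_nonneg (α := ℝ)] : (m : ℝ) ≤ 2 * n)

theorem exists_div_sqrt_le_coinProb (σ : ℝ) : ∃ κ : ℝ, 0 < κ ∧ κ < 1 ∧ ∀ᶠ n : ℕ in atTop,
    ∀ i j : ℕ, |(i : ℝ) - n| ≤ σ * √n → |(j : ℝ) - n| ≤ σ * √n →
      κ / √n ≤ coinProb (i + j) i := by
  refine ⟨Real.exp (-(16 * σ ^ 2)) / 4, by positivity, ?_, ?_⟩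
  · linarith [Real.exp_le_one_iff.2 (neg_nonpos.2 (by positivity : 0 ≤ 16 * σ ^ 2))]
  filter_upwards [eventually_le_two_mul_of_abs_sub_le σ, eventually_ge_atTop 2] with n h_le hn i j
    hi hj
  have hn_pos : (0 : ℝ) < n := by positivity
  have h_quarter : (n : ℝ) / 4 ≤ (n / 2 : ℕ) := by
    have : n ≤ 4 * (n / 2) := by lia
    have : (n : ℝ) ≤ 4 * (n / 2 : ℕ) := by exact_mod_cast this
    linarith
  have h_dist : ((i : ℝ) - j) ^ 2 ≤ 4 * σ ^ 2 * n := by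
    have h_abs : |(i : ℝ) - j| ≤ 2 * (σ * √n) := by
      rw [abs_le] at hi hj ⊢
      constructor <;> linarith
    calc ((i : ℝ) - j) ^ 2 ≤ (2 * (σ * √n)) ^ 2 := sq_le_sq.2 (h_abs.trans (le_abs_self _))
      _ = 4 * σ ^ 2 * n := by rw [mul_pow, mul_pow, Real.sq_sqrt hn_pos.le]; ring
  have h_exponent : ((i : ℝ) - j) ^ 2 / (n / 2 : ℕ) ≤ 16 * σ ^ 2 := by
    calc ((i : ℝ) - j) ^ 2 / (n / 2 : ℕ) ≤ 4 * σ ^ 2 * n / (n / 4) := by gcongr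
      _ = 16 * σ ^ 2 := by field_simp; ring
  have h_sqrt : √((i + j : ℕ) : ℝ) ≤ 2 * √n := by
    have : i + j ≤ 4 * n := by linarith [(h_le i hi).2, (h_le j hj).2]
    refine Real.sqrt_le_iff.2 ⟨by positivity, ?_⟩
    rw [mul_pow, Real.sq_sqrt hn_pos.le]
    norm_num
    exact_mod_cast this
  calc Real.exp (-(16 * σ ^ 2)) / 4 / √n = Real.exp (-(16 * σ ^ 2)) / (2 * (2 * √n)) := by
        field_simp
        norm_num
    _ ≤ Real.exp (-(((i : ℝ) - j) ^ 2 / (n / 2 : ℕ))) / (2 * √(i + j : ℕ)) := by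
        have : 0 < i + j := by linarith [(h_le i hi).1]
        gcongr
    _ ≤ coinProb (i + j) i := exp_div_le_coinProb (by lia)
        (by linarith [(h_le i hi).1, Nat.div_mul_le_self n 2])
        (by linarith [(h_le j hj).1, Nat.div_mul_le_self n 2])

theorem exists_le_sum_coinProb_of_sqrt_le_card {σ : ℝ} (hσ : 0 ≤ σ) :
    ∃ δ : ℝ, 0 < δ ∧ δ < 1 ∧ ∀ᶠ n : ℕ in atTop, ∀ m : ℕ, |(m : ℝ) - n| ≤ σ * √n →
      ∀ S : Finset ℕ, √n ≤ S.card → (∀ j ∈ S, j ≤ n + m ∧ |(j : ℝ) - n| ≤ √n) →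
        δ ≤ ∑ j ∈ S, coinProb (n + m) j := by
  obtain ⟨κ, hκ0, hκ1, h_coin⟩ := exists_div_sqrt_le_coinProb (σ + 1)
  refine ⟨κ, hκ0, hκ1, ?_⟩
  filter_upwards [h_coin, eventually_gt_atTop 0] with n h_coin hn m hm S h_card hS
  have : 0 ≤ σ * √n := by positivity
  calc κ = √n * (κ / √n) := by field_simp
    _ ≤ S.card * (κ / √n) := by gcongr
    _ ≤ ∑ j ∈ S, coinProb (n + m) j := by
      rw [← nsmul_eq_mul]
      refine Finset.card_nsmul_le_sum _ _ _ fun j hj => ?_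
      obtain ⟨hj_le, hj_near⟩ := hS j hj
      have h_split := h_coin j (n + m - j) (by linarith) (by
        rw [Nat.cast_sub hj_le, Nat.cast_add]
        rw [abs_le] at hj_near hm ⊢
        constructor <;> linarith)
      rwa [Nat.add_sub_cancel' hj_le] at h_split

theorem exists_le_sum_coinProb {σ : ℝ} (hσ : 0 ≤ σ) :
    ∃ δ : ℝ, 0 < δ ∧ δ < 1 ∧ ∀ᶠ n : ℕ in atTop, ∀ m : ℕ, |(m : ℝ) - n| ≤ σ * √n →
      δ ≤ ∑ j ∈ Finset.Iic n, coinProb (n + m) j ∧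
        δ ≤ ∑ j ∈ Finset.Icc n (n + m), coinProb (n + m) j := by
  obtain ⟨δ, hδ0, hδ1, h_window⟩ := exists_le_sum_coinProb_of_sqrt_le_card hσ
  refine ⟨δ, hδ0, hδ1, ?_⟩
  filter_upwards [h_window, eventually_le_two_mul_of_abs_sub_le σ] with n h_window h_le m hm
  have h_sqrt_le : (n.sqrt : ℝ) ≤ √n := Real.nat_sqrt_le_real_sqrt
  have h_le_sqrt : √(n : ℝ) ≤ (n.sqrt + 1 : ℕ) := by
    exact_mod_cast Real.real_sqrt_le_nat_sqrt_succ
  have h_sqrt_le_self := n.sqrt_le_self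
  have h_sqrt_le_m : n.sqrt ≤ m := by nlinarith [(h_le m hm).1, n.sqrt_le]
  constructor
  · refine (h_window m hm (Finset.Icc (n - n.sqrt) n) ?_ fun j hj => ?_).trans
      (Finset.sum_le_sum_of_subset_of_nonneg Finset.Icc_subset_Iic_self
        fun j _ _ => coinProb_nonneg _ _)
    · rwa [Nat.card_Icc, show n + 1 - (n - n.sqrt) = n.sqrt + 1 by lia]
    · obtain ⟨hj_low, hj_high⟩ := Finset.mem_Icc.1 hj
      have : (n : ℝ) ≤ j + n.sqrt := by exact_mod_cast Nat.sub_le_iff_le_add.1 hj_low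
      have : (j : ℝ) ≤ n := by exact_mod_cast hj_high
      exact ⟨by lia, abs_le.2 ⟨by linarith, by linarith⟩⟩
  · refine (h_window m hm (Finset.Icc n (n + n.sqrt)) ?_ fun j hj => ?_).trans
      (Finset.sum_le_sum_of_subset_of_nonneg (Finset.Icc_subset_Icc_right (by lia))
        fun j _ _ => coinProb_nonneg _ _)
    · rwa [Nat.card_Icc, show n + n.sqrt + 1 - n = n.sqrt + 1 by lia]
    · obtain ⟨hj_low, hj_high⟩ := Finset.mem_Icc.1 hj
      have : (j : ℝ) ≤ n + n.sqrt := by exact_mod_cast hj_high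
      have : (n : ℝ) ≤ j := by exact_mod_cast hj_low
      exact ⟨by lia, abs_le.2 ⟨by linarith, by linarith⟩⟩

theorem half_le_abs_mul_sub_mul {n m p q : ℕ} (hpq : p ≠ q)
    (h_drift : |(q : ℝ) * (m - n)| ≤ n / 2) : (n : ℝ) / 2 ≤ |(p * n - q * m : ℝ)| := by
  have h_one : (1 : ℝ) ≤ |(p : ℝ) - q| := by
    exact_mod_cast Int.one_le_abs (sub_ne_zero.2 (Nat.cast_injective.ne hpq) : (p : ℤ) - q ≠ 0)
  calc (n : ℝ) / 2 ≤ |(p : ℝ) - q| * n - |(q : ℝ) * (m - n)| := by nlinarith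
    _ = |((p : ℝ) - q) * n| - |(q : ℝ) * (m - n)| := by rw [abs_mul _ (n : ℝ), Nat.abs_cast]
    _ ≤ |((p : ℝ) - q) * n - q * (m - n)| := abs_sub_abs_le_abs_sub _ _
    _ = |(p * n - q * m : ℝ)| := by ring_nf

theorem sqrt_div_four_le_sq_div {σ : ℝ} (hσ : 0 ≤ σ) {n m J p q : ℕ} (hn : 0 < n)
    (hnm : n ≤ 2 * m) (hmn : m ≤ 2 * n) (h_near : |(m : ℝ) - n| ≤ σ * √n)
    (hJ : J ≤ √n / (6 * (σ + 1))) (hpq : p ≠ q) (h_le : p * n + q * m ≤ J * (n + m)) :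
    √n / 4 ≤ (p * n - q * m : ℝ) ^ 2 / (2 * (p * n + q * m)) := by
  have hm : 0 < m := by lia
  have hn_real : (0 : ℝ) < n := by positivity
  have h_sqrt : √(n : ℝ) * √n = n := Real.mul_self_sqrt hn_real.le
  have hJσ : J * (6 * (σ + 1)) ≤ √n := (le_div_iff₀ (by positivity)).1 hJ
  have hq : (q : ℝ) ≤ 3 * J := by
    have : q * m ≤ 3 * J * m := by nlinarith
    exact_mod_cast Nat.le_of_mul_le_mul_right this hm
  have h_drift : |(q : ℝ) * (m - n)| ≤ n / 2 := by
    rw [abs_mul, Nat.abs_cast]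
    calc (q : ℝ) * |(m : ℝ) - n| ≤ 3 * J * (σ * √n) := by gcongr
      _ ≤ √n / 2 * √n := by
        rw [← mul_assoc]
        gcongr
        nlinarith [J.cast_nonneg (α := ℝ)]
      _ = n / 2 := by rw [div_mul_eq_mul_div, h_sqrt]
  have h_gap : (n : ℝ) / 2 ≤ |(p * n - q * m : ℝ)| := half_le_abs_mul_sub_mul hpq h_drift
  have h_pos : (0 : ℝ) < p * n + q * m := by
    refine (half_pos hn_real).trans_le (h_gap.trans ((abs_sub _ _).trans_eq ?_))
    rw [abs_of_nonneg (by positivity), abs_of_nonneg (by positivity)]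
  have h_length : (p * n + q * m : ℝ) ≤ √n / 2 * n := by
    calc (p * n + q * m : ℝ) ≤ J * (n + m) := by exact_mod_cast h_le
      _ ≤ J * (3 * n) := by
        have : (m : ℝ) ≤ 2 * n := by exact_mod_cast hmn
        gcongr
        linarith
      _ ≤ √n / 2 * n := by nlinarith [mul_nonneg (J.cast_nonneg (α := ℝ)) hσ]
  rw [le_div_iff₀ (by positivity)]
  calc √(n : ℝ) / 4 * (2 * (p * n + q * m)) ≤ √n / 4 * (2 * (√n / 2 * n)) := by gcongr
    _ = (n / 2 : ℝ) ^ 2 := by linear_combination n / 4 * h_sqrt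
    _ ≤ |(p * n - q * m : ℝ)| ^ 2 := by gcongr
    _ = (p * n - q * m : ℝ) ^ 2 := sq_abs _

theorem exists_law_real_offDiagonal_le_exp {σ : ℝ} (hσ : 0 ≤ σ) :
    ∃ a : ℝ, 0 < a ∧ ∀ᶠ n : ℕ in atTop, ∀ m : ℕ, |(m : ℝ) - n| ≤ σ * √n →
      (law n m).real (offDiagonal n m) ≤ Real.exp (-(a * √n)) := by
  obtain ⟨δ, hδ0, hδ1, h_sums⟩ := exists_le_sum_coinProb hσ
  set ε : ℝ := 1 / (6 * (σ + 1)) with hε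
  have hε0 : 0 < ε := by positivity
  have hε1 : ε ≤ 1 / 6 := by
    rw [hε]
    gcongr
    linarith
  obtain ⟨a, ha0, haδ, ha⟩ : ∃ a : ℝ, 0 < a ∧ a ≤ δ * ε ∧ a ≤ 1 / 4 :=
    ⟨min (δ * ε) (1 / 4), by positivity, min_le_left _ _, min_le_right _ _⟩
  refine ⟨a / 2, half_pos ha0, ?_⟩
  filter_upwards [h_sums, eventually_le_two_mul_of_abs_sub_le σ, eventually_ge_atTop 1,
    eventually_mul_pow_mul_exp_le 20 3 (half_lt_self ha0)] with n h_sums h_le hn h_poly m hm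
  obtain ⟨hnm, hmn⟩ := h_le m hm
  have : NeZero n := ⟨by lia⟩
  have : NeZero m := ⟨by lia⟩
  have hn_real : (1 : ℝ) ≤ n := by exact_mod_cast hn
  have hmn_real : (m : ℝ) ≤ 2 * n := by exact_mod_cast hmn
  have h_one : 1 ≤ √(n : ℝ) := Real.one_le_sqrt.2 hn_real
  set J := ⌊ε * √n⌋₊
  have hJ_le : (J : ℝ) ≤ ε * √n := Nat.floor_le (by positivity)
  have h_blocks : (1 - δ) ^ J ≤ 3 * Real.exp (-(a * √n)) := by
    refine (one_sub_pow_floor_le hδ0.le hδ1.le _).trans ?_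
    rw [← mul_assoc δ]
    gcongr
  have h_classes : (3 * (J : ℝ) + 1) ^ 2 ≤ 4 * (n : ℝ) := by
    have : 3 * (J : ℝ) + 1 ≤ 2 * √n := by nlinarith
    nlinarith [Real.sq_sqrt (n.cast_nonneg (α := ℝ)), J.cast_nonneg (α := ℝ)]
  calc (law n m).real (offDiagonal n m)
      ≤ n * m * (2 * (1 - δ) ^ J + (3 * J + 1) ^ 2 * Real.exp (-(a * √n))) :=
        law_real_offDiagonal_le hmn hnm (h_sums m hm).1 (h_sums m hm).2 (Real.exp_pos _).le
          fun p q hpq h_short => Real.exp_le_exp.2 <| neg_le_neg <|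
            (by nlinarith [ha] : a * √n ≤ √n / 4).trans <| sqrt_div_four_le_sq_div hσ hn hnm hmn hm
              (hJ_le.trans_eq (one_div_mul_eq_div _ _)) hpq h_short
    _ ≤ n * (2 * n) * (2 * (3 * Real.exp (-(a * √n))) + 4 * n * Real.exp (-(a * √n))) := by gcongr
    _ ≤ 20 * n ^ 3 * Real.exp (-(a * √n)) := by
        have : (n : ℝ) ^ 2 ≤ n ^ 3 := pow_le_pow_right₀ hn_real (by norm_num)
        nlinarith [Real.exp_pos (-(a * √n))]
    _ ≤ Real.exp (-(a / 2 * √n)) := h_poly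

theorem exists_law_real_numCycles_le_exp {σ : ℝ} (hσ : 0 ≤ σ) :
    ∃ b : ℝ, 0 < b ∧ ∀ᶠ n : ℕ in atTop, ∀ m : ℕ, |(m : ℝ) - n| ≤ σ * √n →
      (law n m).real {ω | ω ∉ offDiagonal n m ∧ (numCycles 1 1 ω : ℝ) ≤ b * √n}
        ≤ Real.exp (-(b * √n)) := by
  obtain ⟨κ, hκ0, -, h_coin⟩ := exists_div_sqrt_le_coinProb σ
  refine ⟨κ / 12, by positivity, ?_⟩
  filter_upwards [h_coin, eventually_le_two_mul_of_abs_sub_le σ, eventually_gt_atTop 0] with n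
    h_coin h_le hn m hm
  obtain ⟨hnm, -⟩ := h_le m hm
  have : NeZero n := ⟨by lia⟩
  have : NeZero m := ⟨by lia⟩
  have hnm_real : (n : ℝ) ≤ 2 * m := by exact_mod_cast hnm
  have h_mean : κ / 6 * √n ≤ n * m * coinProb (n + m) n / (2 * (n + m)) := by
    have h_third : (n : ℝ) / 6 ≤ n * m / (2 * (n + m)) := by
      rw [div_le_div_iff₀ (by positivity) (by positivity)]
      nlinarith [n.cast_nonneg (α := ℝ)]
    have h_prob : κ / √n ≤ coinProb (n + m) n :=
      h_coin n m (by rw [sub_self, abs_zero]; positivity) hm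
    calc κ / 6 * √n = √n ^ 2 / 6 * (κ / √n) := by field_simp
      _ = n / 6 * (κ / √n) := by rw [Real.sq_sqrt n.cast_nonneg]
      _ ≤ n * m / (2 * (n + m)) * coinProb (n + m) n := by gcongr
      _ = n * m * coinProb (n + m) n / (2 * (n + m)) := by ring
  refine (law_real_numCycles_le _).trans (Real.exp_le_exp.2 ?_)
  have h_log : κ / 12 * √n * Real.log 2 ≤ κ / 12 * √n :=
    mul_le_of_le_one_right (by positivity) (Real.log_two_lt_d9.le.trans (by norm_num))
  linarith

theorem law_real_four_mul_sqrt_lt_numCycles_le {n m : ℕ} [NeZero n] [NeZero m] (hmn : m ≤ 2 * n) :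
    (law n m).real {ω | 4 * √n < (numCycles 1 1 ω : ℝ)} ≤ Real.exp (-(4⁻¹ * √n)) := by
  have hn : 0 < n := NeZero.pos n
  have h_prob : coinProb (n + m) n ≤ 1 / √n :=
    (coinProb_le_one_div_sqrt (by lia : n + m ≠ 0) n).trans <|
      one_div_le_one_div_of_le (by positivity) (Real.sqrt_le_sqrt (by simp))
  have h_mean : m * coinProb (n + m) n ≤ 2 * √n := by
    calc m * coinProb (n + m) n ≤ (2 * n) * (1 / √n) :=
          mul_le_mul (by exact_mod_cast hmn) h_prob (coinProb_nonneg _ _) (by positivity)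
      _ = 2 * √n := by rw [mul_one_div, mul_div_assoc, Real.div_sqrt]
  refine (law_real_lt_numCycles_le _).trans (Real.exp_le_exp.2 ?_)
  nlinarith [Real.log_two_gt_d9, Real.sqrt_nonneg (n : ℝ)]

theorem one_sub_law_real_le_law_real {n m : ℕ} {A B : Set (Config n m)} (h : ∀ ω ∉ B, ω ∈ A) :
    1 - (law n m).real B ≤ (law n m).real A := by
  rw [sub_le_iff_le_add, ← probReal_univ (μ := law n m)]
  exact (measureReal_mono fun ω _ => or_iff_not_imp_right.2 (h ω)).trans (measureReal_union_le A B)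

theorem one_sub_law_real_offDiagonal_le (n m : ℕ) [NeZero n] [NeZero m] :
    1 - (law n m).real (offDiagonal n m)
      ≤ (law n m).real {ω | ∀ C, IsClosedOrbit ω C → HasHomologyClass ω C 1 1} := by
  refine one_sub_law_real_le_law_real fun ω hω C hC => ?_
  obtain ⟨v, hv, rfl⟩ := hC
  exact (minimalPeriod_and_hasHomologyClass_of_notMem_offDiagonal hω hv).2

theorem one_sub_law_real_add_le_law_real_lt_numCycles {n m : ℕ} {x y : ℝ} (hxy : x ≤ y) :
    1 - ((law n m).real (offDiagonal n m)
        + (law n m).real {ω | ω ∉ offDiagonal n m ∧ (numCycles 1 1 ω : ℝ) ≤ y})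
      ≤ (law n m).real {ω | x < (numCycles 1 1 ω : ℝ)} := by
  refine (sub_le_sub_left (measureReal_union_le _ _) 1).trans
    (one_sub_law_real_le_law_real fun ω hω => ?_)
  by_contra h_le
  exact hω (or_iff_not_imp_left.2 fun h_off => ⟨h_off, (not_lt.1 h_le).trans hxy⟩)

theorem eventually_abs_sub_le {ρ : ℝ} (hρ : 0 ≤ ρ) {m : ℕ → ℕ}
    (hm : IsEquivalent atTop (fun n : ℕ => (m n : ℝ) - n) (fun n : ℕ => ρ * √(n : ℝ))) :
    ∀ᶠ n : ℕ in atTop, |(m n : ℝ) - n| ≤ 2 * ρ * √n := by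
  filter_upwards [hm.isLittleO.def one_pos] with n hn
  have h_nonneg : 0 ≤ ρ * √(n : ℝ) := by positivity
  simp only [Pi.sub_apply, Real.norm_eq_abs, one_mul, abs_of_nonneg h_nonneg] at hn
  rw [abs_le] at hn ⊢
  constructor <;> linarith

end Rates

end QuenchedWalk

open QuenchedWalk in
theorem mainTheorem1_general {σ : ℝ} (hσ : 0 ≤ σ) :
    ∃ c : ℝ, 0 < c ∧ ∃ K : ℝ, 0 < K ∧ ∀ᶠ n : ℕ in atTop, ∀ m : ℕ, |(m : ℝ) - n| ≤ σ * √n →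
      (law n m).real {ω | ∀ C, IsClosedOrbit ω C → HasHomologyClass ω C 1 1}
          > 1 - Real.exp (-(c * √n)) ∧
      (law n m).real {ω | (numCycles 1 1 ω : ℝ) > c * √n} ≥ 1 - Real.exp (-(c * √n)) ∧
      (law n m).real {ω | (numCycles 1 1 ω : ℝ) > K * √n} ≤ Real.exp (-(K⁻¹ * √n)) := by
  obtain ⟨a, ha0, h_off⟩ := exists_law_real_offDiagonal_le_exp hσ
  obtain ⟨b, hb0, h_few⟩ := exists_law_real_numCycles_le_exp hσ
  obtain ⟨c, hc0, hca, hcb⟩ : ∃ c : ℝ, 0 < c ∧ c < a ∧ c < b := by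
    obtain ⟨c, hc0, hc⟩ := exists_between (lt_min ha0 hb0)
    exact ⟨c, hc0, lt_min_iff.1 hc⟩
  refine ⟨c, hc0, 4, by norm_num, ?_⟩
  filter_upwards [h_off, h_few, eventually_le_two_mul_of_abs_sub_le σ, eventually_gt_atTop 0,
    eventually_mul_pow_mul_exp_le 2 0 hca, eventually_mul_pow_mul_exp_le 2 0 hcb]
    with n h_off h_few h_le hn h_two_a h_two_b m hm
  have : NeZero n := ⟨hn.ne'⟩
  have : NeZero m := ⟨by have := (h_le m hm).1; lia⟩
  simp only [pow_zero, mul_one] at h_two_a h_two_b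
  refine ⟨?_, ?_, law_real_four_mul_sqrt_lt_numCycles_le (h_le m hm).2⟩
  · linarith [one_sub_law_real_offDiagonal_le n m, h_off m hm, Real.exp_pos (-(a * √n))]
  · have h_many := one_sub_law_real_add_le_law_real_lt_numCycles (n := n) (m := m)
      (mul_le_mul_of_nonneg_right hcb.le (Real.sqrt_nonneg n))
    linarith [h_off m hm, h_few m hm]

theorem mainTheorem1 (ρ : ℝ) (hρ : 0 < ρ) :
    ∃ c : ℝ, 0 < c ∧ ∃ K : ℝ, 0 < K ∧
      ∀ m : ℕ → ℕ,
        IsEquivalent atTop (fun n : ℕ => (m n : ℝ) - (n : ℝ)) (fun n : ℕ => ρ * √(n : ℝ)) →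
        ∀ᶠ n : ℕ in atTop,
          (QuenchedWalk.law n (m n)).real
              {ω | ∀ C, QuenchedWalk.IsClosedOrbit ω C → QuenchedWalk.HasHomologyClass ω C 1 1}
            > 1 - Real.exp (-(c * √(n : ℝ))) ∧
          (QuenchedWalk.law n (m n)).real
              {ω | (QuenchedWalk.numCycles 1 1 ω : ℝ) > c * √(n : ℝ)}
            ≥ 1 - Real.exp (-(c * √(n : ℝ))) ∧
          (QuenchedWalk.law n (m n)).real
              {ω | (QuenchedWalk.numCycles 1 1 ω : ℝ) > K * √(n : ℝ)}
            ≤ Real.exp (-(K⁻¹ * √(n : ℝ))) := by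
  obtain ⟨c, hc, K, hK, h_uniform⟩ := mainTheorem1_general (by positivity : 0 ≤ 2 * ρ)
  refine ⟨c, hc, K, hK, fun m hm => ?_⟩
  filter_upwards [h_uniform, QuenchedWalk.eventually_abs_sub_le hρ.le hm] with n h_n h_near
  exact h_n (m n) h_near
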